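/- Let $X=\{X(t):t\in\mathbb{R}\}$ be a real, centered, stationary Gaussian process with $\mathrm{Var}\,X(t)=1$, whose sample paths are almost surely absolutely continuous (on every bounded interval). Let $r(t)=\mathrm{Cov}[X(t),X(0)]$ be its covariance function and $\rho$ its spectral measure, i.e. the probability measure on $\mathbb{R}$ such that $r(t)=\int_{\mathbb{R}}e^{-i\lambda t}\,d\rho(\lambda)$ for all $t\in\mathbb{R}$. Fix $\kappa>0$, and suppose that at least one of the following two conditions holds. (a) The support of $\rho$ is compact and $\int_{\mathbb{R}}|r(t)|\,dt<\infty$. (b) $\int_{\mathbb{R}}e^{\kappa|\lambda|}\,d\rho(\lambda)<\infty$ and, for some $\kappa_o\in(0,\kappa/2)$, $\int_{\mathbb{R}}|r(t;\kappa_o)|\,dt<\infty$, where $r(t;\kappa_o):=\int_{\mathbb{R}}\cos(t\lambda)\cosh(2\kappa_o\lambda)\,d\rho(\lambda)$. Then: (i) Assumption A holds with this $\kappa$. That is, $\rho$ has no atoms, $\int_{\mathbb{R}} e^{\kappa|\lambda|}\,d\rho(\lambda)<\infty$, and there are $\kappa'\in(0,\kappa/2)$ and $x_\star\in(0,\infty)$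 for which, writing $\varphi(u)=\sinh(u)/u$ (with $\varphi(0)=1$) and $$r_\ell(x;y):=\int_{\mathbb{R}}e^{-i\lambda x}\varphi(\lambda y)^\ell\,d\rho(\lambda),\qquad \ell=1,2,$$ the functions $x\mapsto r_1(x;2y)$ and $x\mapsto r_2(x;y)$ are, for every $|y|<\kappa'$, continuously differentiable and twice continuously differentiable respectively, and, with primes denoting derivatives in $x$, $$\omega_\star(k):=\sum_{j\ge k}|r(jx_\star)|+\sup_{|y|<\kappa'}\Big\{\sum_{j\ge k}|r_1'(jx_\star;2y)|+\sum_{j\ge k}|r_2''(jx_\star;y)|\Big\}\longrightarrow 0\qquad\text{as }k\to\infty .$$ (ii) $\rho$ has a bounded, continuous density with respect to Lebesgue measure. (iii) Almost surely, the sample path $t\mapsto X(t)$ belongs to $C^\infty(\mathbb{R})$. -/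

import Mathlib

open MeasureTheory ProbabilityTheory Filter Topology
open scoped ENNReal

namespace StationaryGaussian

noncomputable section

/-- A real, centered, stationary Gaussian process on `ℝ`, normalized to have variance one, whose
sample paths are almost surely (locally) absolutely continuous. -/
structure IsNormalizedStationaryGaussian {Ω : Type*} [MeasurableSpace Ω]
    (X : ℝ → Ω → ℝ) (P : Measure Ω) : Prop where
  gaussian : IsGaussianProcess X P
  centered : ∀ t : ℝ, ∫ ω, X t ω ∂P = 0
  /-- Finite-dimensional marginals are invariant under real shifts. -/
  stationary : ∀ (h : ℝ) (I : Finset ℝ),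
    IdentDistrib (fun ω (i : I) ↦ X ((i : ℝ) + h) ω) (fun ω (i : I) ↦ X (i : ℝ) ω) P P
  variance_one : ∀ t : ℝ, Var[X t; P] = 1
  paths : ∀ᵐ ω ∂P, ∀ a b : ℝ, AbsolutelyContinuousOnInterval (fun t ↦ X t ω) a b

/-- The covariance function `r(t) = Cov(X(t), X(0))` of a stationary process. -/
def autocov {Ω : Type*} [MeasurableSpace Ω] (X : ℝ → Ω → ℝ) (P : Measure Ω) (t : ℝ) : ℝ :=
  cov[X t, X 0; P]

/-- The Fourier transform `x ↦ ∫ e^{-i ξ x} dρ(ξ)` of `ρ`. -/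
def fourierCov (ρ : Measure ℝ) (x : ℝ) : ℂ :=
  ∫ ξ : ℝ, Complex.exp (-Complex.I * (ξ : ℂ) * (x : ℂ)) ∂ρ

/-- `ρ` is the spectral measure of the stationary process `X`: the (unique) probability measure
on `ℝ` with `r(t) = ∫ e^{-i ξ t} dρ(ξ)` for all `t`. -/
structure IsSpectralMeasure {Ω : Type*} [MeasurableSpace Ω]
    (X : ℝ → Ω → ℝ) (P : Measure Ω) (ρ : Measure ℝ) : Prop where
  isProbabilityMeasure : IsProbabilityMeasure ρ
  autocov_eq : ∀ t : ℝ, (autocov X P t : ℂ) = fourierCov ρ t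

/-- The exponential moment condition `∫ e^{κ|ξ|} dρ(ξ) < ∞`. -/
def ExpMoment (ρ : Measure ℝ) (κ : ℝ) : Prop :=
  Integrable (fun ξ : ℝ ↦ Real.exp (|ξ| * κ)) ρ

/-- `φ(u) = sinh(u) / u`, extended continuously by `φ(0) = 1`. -/
def sinhc (u : ℝ) : ℝ := if u = 0 then 1 else Real.sinh u / u

/-- `r_ℓ(x; y) = ∫ e^{-i ξ x} φ(ξ y)^ℓ dρ(ξ)`. -/
def rEll (ρ : Measure ℝ) (ℓ : ℕ) (x y : ℝ) : ℂ :=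
  ∫ ξ : ℝ, Complex.exp (-Complex.I * (ξ : ℂ) * (x : ℂ)) * ((sinhc (ξ * y) ^ ℓ : ℝ) : ℂ) ∂ρ

/-- `r(t; κₒ) = ∫ cos(t ξ) cosh(2 κₒ ξ) dρ(ξ)`. -/
def rTilted (ρ : Measure ℝ) (κo : ℝ) (t : ℝ) : ℝ :=
  ∫ ξ : ℝ, Real.cos (t * ξ) * Real.cosh (2 * κo * ξ) ∂ρ

/-- `ω⋆(k) = ∑_{j ≥ k} |r(j x⋆)|
  + sup_{|y| < κ'} { ∑_{j ≥ k} |r₁'(j x⋆; 2y)| + ∑_{j ≥ k} |r₂''(j x⋆; y)| }`,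
with values in `[0, ∞]`; the primes are derivatives in the first variable. -/
def omegaStar (ρ : Measure ℝ) (κ' xstar : ℝ) (k : ℕ) : ℝ≥0∞ :=
  (∑' j : ℕ, ‖fourierCov ρ (((k + j : ℕ) : ℝ) * xstar)‖ₑ) +
  ⨆ (y : ℝ) (_ : |y| < κ'),
    ((∑' j : ℕ, ‖deriv (fun x : ℝ ↦ rEll ρ 1 x (2 * y)) (((k + j : ℕ) : ℝ) * xstar)‖ₑ) +
     (∑' j : ℕ, ‖iteratedDeriv 2 (fun x : ℝ ↦ rEll ρ 2 x y) (((k + j : ℕ) : ℝ) * xstar)‖ₑ))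

/-- Assumption A with exponent `κ > 0`: `ρ` is non-atomic, has finite exponential moment of
order `κ`, and `ω⋆(k) → 0` for some `κ' ∈ (0, κ/2)` and `x⋆ ∈ (0, ∞)`. The regularity clause
records that the derivatives which enter `ω⋆` exist. -/
structure AssumptionA (ρ : Measure ℝ) (κ : ℝ) : Prop where
  noAtoms : ∀ x : ℝ, ρ {x} = 0
  pos : 0 < κ
  expMoment : ExpMoment ρ κ
  decay : ∃ κ' xstar : ℝ, 0 < κ' ∧ κ' < κ / 2 ∧ 0 < xstar ∧
    (∀ y : ℝ, |y| < κ' →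
      ContDiff ℝ 1 (fun x : ℝ ↦ rEll ρ 1 x (2 * y)) ∧ ContDiff ℝ 2 (fun x : ℝ ↦ rEll ρ 2 x y)) ∧
    Tendsto (omegaStar ρ κ' xstar) atTop (𝓝 0)

/-- `ρ` is absolutely continuous with a bounded, continuous (nonnegative) density. -/
def HasBoundedContinuousDensity (ρ : Measure ℝ) : Prop :=
  ∃ p : ℝ → ℝ, Continuous p ∧ (∀ x, 0 ≤ p x) ∧ (∃ C : ℝ, ∀ x, p x ≤ C) ∧
    ρ = volume.withDensity (fun x ↦ ENNReal.ofReal (p x))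

end

end StationaryGaussian

namespace StationaryGaussian

open scoped FourierTransform

/-! ### Fourier multipliers on finite measures -/

/-! Both conditions reduce to one: for some `κo` in `(0, κ/2)`, the tilted measure `cosh(2 κo ξ)
dρ(ξ)` has an integrable Fourier transform `J`. Under (b), `ρ` is symmetric because `r` is real, so
`J` is exactly `rTilted`. Under (a), `cosh` agrees on the support with a smooth compactly supported
multiplier, and such a multiplier preserves integrability of the transform.

The density comes from Fourier inversion for the tilted measure, followed by division by `cosh ≥ 1`.

For Assumption A, put `c = 2 κo`. Both `φ(2ξy)` and `φ(ξy)²` are averages of `cosh(2ξys)` over `s ∈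
[0, 1]`, hence of exponentials `exp(2aξ)` with `|a| ≤ |y| ≤ c/4`. Relative to the tilted measure,
the weights `1`, `ξ`, `ξ²` times such an exponential become multipliers `p(ξ) exp(2aξ) / cosh(cξ)`,
integrable with two derivatives uniformly in `a`. Their Fourier transforms are `O(1/(1+t²))`, so
`r`, `r₁'` and `r₂''` are all dominated by a multiple of one function, `|J|` smeared by that kernel
(`exists_exp_multiplier_bound`). Its samples on `2πℕ` are summable because the translates of the
kernel by integers have bounded sum; `ω⋆(k)` is then at most the tail of a convergent series.

For the paths, localise by a smooth cutoff `χ`. The mean of `|𝓕(χX)(s)|²` is the integral of `|𝓕χ(s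
+ ξ/2π)|²` against `ρ`. Since `ρ` has all polynomial moments and `𝓕χ` is Schwartz, `𝓕(χX)` is almost
surely square integrable against every polynomial weight, and inversion makes `χX` smooth. -/

lemma norm_exp_neg_I_mul (ξ x : ℝ) : ‖Complex.exp (-Complex.I * (ξ : ℂ) * (x : ℂ))‖ = 1 := by
  rw [show -Complex.I * (ξ : ℂ) * (x : ℂ) = ((-(ξ * x) : ℝ) : ℂ) * Complex.I by push_cast; ring]
  exact Complex.norm_exp_ofReal_mul_I _

/-- Fubini: a multiplier acts on `fourierCov μ` as convolution with its Fourier transform. The scale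
`2π` reconciles `exp(-iξx)` here with `exp(2πiξt)` in `𝓕⁻`. -/
lemma integral_exp_mul_fourierInv (μ : Measure ℝ) [IsFiniteMeasure μ] {G : ℝ → ℂ}
    (hG : Integrable G) (x : ℝ) :
    ∫ ξ : ℝ, Complex.exp (-Complex.I * (ξ : ℂ) * (x : ℂ)) * 𝓕⁻ G ξ ∂μ =
      ∫ t : ℝ, G t * fourierCov μ (x - 2 * Real.pi * t) := by
  have h1 : ∀ ξ : ℝ, Complex.exp (-Complex.I * (ξ : ℂ) * (x : ℂ)) * 𝓕⁻ G ξ =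
      ∫ t : ℝ, G t * Complex.exp (-Complex.I * (ξ : ℂ) * ((x - 2 * Real.pi * t : ℝ) : ℂ)) := by
    intro ξ
    rw [Real.fourierInv_eq', ← integral_const_mul]
    refine integral_congr_ae (.of_forall fun t ↦ ?_)
    simp only [smul_eq_mul, RCLike.inner_apply, conj_trivial]
    rw [← mul_assoc, ← Complex.exp_add, mul_comm]
    congr 2
    push_cast
    ring
  simp_rw [h1]
  rw [integral_integral_swap]
  · refine integral_congr_ae (.of_forall fun t ↦ ?_)
    simp only [fourierCov, integral_const_mul]
  · have h2 : Integrable (fun p : ℝ × ℝ ↦ G p.2) (μ.prod volume) := hG.comp_snd μ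
    refine h2.mul_bdd (c := 1) ?_ (.of_forall fun p ↦ (norm_exp_neg_I_mul _ _).le)
    exact (by fun_prop : Continuous fun p : ℝ × ℝ ↦
      Complex.exp (-Complex.I * (p.1 : ℂ) * ((x - 2 * Real.pi * p.2 : ℝ) : ℂ))).aestronglyMeasurable

/-- The majorant `x ↦ ∫ |J(x - 2πt)| / (1 + t²) dt`. -/
noncomputable def majorant (J : ℝ → ℂ) (x : ℝ) : ℝ≥0∞ :=
  ∫⁻ t : ℝ, ENNReal.ofReal (1 / (1 + t ^ 2)) * ‖J (x - 2 * Real.pi * t)‖ₑ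

/-- Two derivatives cost a factor `(2πt)²`, which the `L¹` norm of `m''` controls; `(2π)² ≥ 1` is
simply dropped. -/
lemma norm_fourier_le_of_hasDerivAt {m m' m'' : ℝ → ℂ} (h1 : ∀ ξ, HasDerivAt m (m' ξ) ξ)
    (h2 : ∀ ξ, HasDerivAt m' (m'' ξ) ξ) (hm : Integrable m) (hm' : Integrable m')
    (hm'' : Integrable m'') (t : ℝ) :
    ‖𝓕 m t‖ ≤ ((∫ ξ, ‖m ξ‖) + ∫ ξ, ‖m'' ξ‖) * (1 / (1 + t ^ 2)) := by
  have d1 : deriv m = m' := funext fun ξ ↦ (h1 ξ).deriv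
  have d2 : deriv m' = m'' := funext fun ξ ↦ (h2 ξ).deriv
  have e1 : 𝓕 m' t = (2 * Real.pi * Complex.I * t) • 𝓕 m t := by
    rw [← d1, Real.fourier_deriv hm (fun ξ ↦ (h1 ξ).differentiableAt) (by rwa [d1])]
  have e2 : 𝓕 m'' t = (2 * Real.pi * Complex.I * t) • 𝓕 m' t := by
    rw [← d2, Real.fourier_deriv hm' (fun ξ ↦ (h2 ξ).differentiableAt) (by rwa [d2])]
  have b0 : ‖𝓕 m t‖ ≤ ∫ ξ, ‖m ξ‖ := by
    rw [Real.fourier_real_eq]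
    exact (norm_integral_le_integral_norm _).trans_eq (by simp [Circle.norm_smul])
  have b2 : ‖𝓕 m'' t‖ ≤ ∫ ξ, ‖m'' ξ‖ := by
    rw [Real.fourier_real_eq]
    exact (norm_integral_le_integral_norm _).trans_eq (by simp [Circle.norm_smul])
  rw [e2, e1, smul_smul, norm_smul] at b2
  have e3 : ‖2 * (Real.pi : ℂ) * Complex.I * t * (2 * Real.pi * Complex.I * t)‖ =
      (2 * Real.pi) ^ 2 * t ^ 2 := by
    simp only [norm_mul, Complex.norm_I, Complex.norm_real, Real.norm_eq_abs,
      abs_of_pos Real.pi_pos, Complex.norm_ofNat]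
    rw [← sq_abs t]
    ring
  rw [e3] at b2
  rw [mul_one_div, le_div_iff₀ (by positivity)]
  have hpi : (1 : ℝ) ≤ (2 * Real.pi) ^ 2 := by nlinarith [Real.pi_gt_three]
  nlinarith [mul_nonneg (sq_nonneg t) (norm_nonneg (𝓕 m t))]

lemma continuous_fourier_of_integrable {f : ℝ → ℂ} (hf : Integrable f) : Continuous (𝓕 f) :=
  VectorFourier.fourierIntegral_continuous Real.continuous_fourierChar
    (by exact continuous_inner) hf

lemma integrable_fourier_of_hasDerivAt {m m' m'' : ℝ → ℂ} (h1 : ∀ ξ, HasDerivAt m (m' ξ) ξ)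
    (h2 : ∀ ξ, HasDerivAt m' (m'' ξ) ξ) (hm : Integrable m) (hm' : Integrable m')
    (hm'' : Integrable m'') : Integrable (𝓕 m) := by
  have hc := continuous_fourier_of_integrable hm
  refine Integrable.mono' (g := fun t ↦ ((∫ ξ, ‖m ξ‖) + ∫ ξ, ‖m'' ξ‖) * (1 / (1 + t ^ 2))) ?_
    hc.aestronglyMeasurable
    (.of_forall (norm_fourier_le_of_hasDerivAt h1 h2 hm hm' hm''))
  have h : Integrable fun t : ℝ ↦ 1 / (1 + t ^ 2) := by simpa using integrable_inv_one_add_sq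
  exact h.const_mul _

/-- A multiplier `m` with integrable derivatives up to order two acts on `fourierCov μ` with a
quadratically decaying kernel. -/
lemma enorm_integral_exp_mul_le (μ : Measure ℝ) [IsFiniteMeasure μ] {m m' m'' : ℝ → ℂ}
    (h1 : ∀ ξ, HasDerivAt m (m' ξ) ξ) (h2 : ∀ ξ, HasDerivAt m' (m'' ξ) ξ) (hm : Integrable m)
    (hm' : Integrable m') (hm'' : Integrable m'') {B : ℝ}
    (hB : (∫ ξ, ‖m ξ‖) + ∫ ξ, ‖m'' ξ‖ ≤ B) (x : ℝ) :
    ‖∫ ξ : ℝ, Complex.exp (-Complex.I * (ξ : ℂ) * (x : ℂ)) * m ξ ∂μ‖ₑ ≤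
      ENNReal.ofReal B * majorant (fourierCov μ) x := by
  have hG := integrable_fourier_of_hasDerivAt h1 h2 hm hm' hm''
  have hinv : 𝓕⁻ (𝓕 m) = m :=
    Continuous.fourierInv_fourier_eq
      (continuous_iff_continuousAt.2 fun ξ ↦ (h1 ξ).continuousAt) hm hG
  have h := integral_exp_mul_fourierInv μ hG x
  rw [hinv] at h
  rw [h, majorant, ← lintegral_const_mul' _ _ ENNReal.ofReal_ne_top]
  refine (enorm_integral_le_lintegral_enorm _).trans (lintegral_mono fun t ↦ ?_)
  have hB0 : 0 ≤ B := le_trans (by positivity) hB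
  rw [enorm_mul, ← mul_assoc, ← ENNReal.ofReal_mul hB0]
  gcongr
  rw [← ofReal_norm]
  exact ENNReal.ofReal_le_ofReal ((norm_fourier_le_of_hasDerivAt h1 h2 hm hm' hm'' t).trans
    (by gcongr))

/-! ### Summing and integrating the majorant -/

lemma continuous_fourierCov (μ : Measure ℝ) [IsFiniteMeasure μ] : Continuous (fourierCov μ) := by
  refine continuous_of_dominated (bound := fun _ ↦ 1) (fun x ↦ ?_)
    (fun x ↦ .of_forall fun ξ ↦ (norm_exp_neg_I_mul _ _).le) (integrable_const _)
    (.of_forall fun ξ ↦ by fun_prop)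
  exact (by fun_prop : Continuous fun ξ : ℝ ↦
    Complex.exp (-Complex.I * (ξ : ℂ) * (x : ℂ))).aestronglyMeasurable

lemma tsum_one_div_one_add_sub_sq_le :
    ∃ C : ℝ≥0∞, C ≠ ∞ ∧ ∀ s : ℝ, ∑' j : ℕ, ENNReal.ofReal (1 / (1 + ((j : ℝ) - s) ^ 2)) ≤ C := by
  have hs : Summable fun i : ℤ ↦ 3 / (1 + (i : ℝ) ^ 2) := by
    have h0 : Summable fun i : ℤ ↦ 1 / (i : ℝ) ^ 2 := by
      simpa using Real.summable_one_div_int_pow.2 one_lt_two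
    have h1 := (h0.mul_left 3).add ((hasSum_ite_eq (0 : ℤ) (3 : ℝ)).summable)
    refine h1.of_nonneg_of_le (fun i ↦ by positivity) fun i ↦ ?_
    by_cases hi : i = 0
    · simp [hi]
    · have : (0 : ℝ) < (i : ℝ) ^ 2 := by positivity
      simp only [hi, if_false, add_zero, mul_one_div]
      gcongr
      linarith
  refine ⟨∑' i : ℤ, ENNReal.ofReal (3 / (1 + (i : ℝ) ^ 2)), ?_, fun s ↦ ?_⟩
  · rw [← ENNReal.ofReal_tsum_of_nonneg (fun i ↦ by positivity) hs]
    exact ENNReal.ofReal_ne_top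
  · have hinj : Function.Injective fun j : ℕ ↦ (j : ℤ) - ⌊s⌋ := fun a b h ↦ by
      simpa using h
    refine le_trans (ENNReal.tsum_le_tsum fun j ↦ ENNReal.ofReal_le_ofReal ?_)
      (ENNReal.tsum_comp_le_tsum_of_injective hinj _)
    have h1 := Int.floor_le s
    have h2 := Int.lt_floor_add_one s
    push_cast
    rw [div_le_div_iff₀ (by positivity) (by positivity)]
    -- With `θ = s - ⌊s⌋ ∈ [0, 1)`, `(j - ⌊s⌋)² ≤ 2(j - s)² + 2θ²`; this is the source of the
    -- constant 3.
    nlinarith [sq_nonneg ((j : ℝ) - s - (s - ⌊s⌋)),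
      mul_nonneg (sub_nonneg.2 h1) (by linarith : 0 ≤ 1 - (s - ⌊s⌋))]

/-- At `x = 2πj` the substitution `s = j - t` leaves `J(2πs)` independent of `j`, so the sum falls
on the kernel alone and is bounded uniformly in `s`. -/
lemma tsum_majorant_lt_top {J : ℝ → ℂ} (hJ : Integrable J) (hJm : Measurable J) :
    ∑' j : ℕ, majorant J ((j : ℝ) * (2 * Real.pi)) < ∞ := by
  obtain ⟨C, hC, hCs⟩ := tsum_one_div_one_add_sub_sq_le
  have h1 : ∀ j : ℕ, majorant J ((j : ℝ) * (2 * Real.pi)) =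
      ∫⁻ s : ℝ, ENNReal.ofReal (1 / (1 + ((j : ℝ) - s) ^ 2)) * ‖J (2 * Real.pi * s)‖ₑ := by
    intro j
    rw [majorant, ← lintegral_sub_left_eq_self _ (j : ℝ)]
    refine lintegral_congr fun s ↦ ?_
    congr 3
    ring
  simp_rw [h1]
  rw [← lintegral_tsum (fun j ↦ by fun_prop)]
  simp_rw [ENNReal.tsum_mul_right]
  refine lt_of_le_of_lt (lintegral_mono fun s ↦ mul_le_mul_left (hCs s) _) ?_
  rw [lintegral_const_mul' _ _ hC]
  refine ENNReal.mul_lt_top hC.lt_top ?_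
  exact (hJ.comp_mul_left' (by positivity : 2 * Real.pi ≠ 0)).2

lemma lintegral_majorant_lt_top {J : ℝ → ℂ} (hJ : Integrable J) (hJm : Measurable J) :
    ∫⁻ x, majorant J x < ∞ := by
  unfold majorant
  rw [lintegral_lintegral_swap (by fun_prop)]
  have h1 : ∀ t : ℝ, ∫⁻ x : ℝ, ENNReal.ofReal (1 / (1 + t ^ 2)) * ‖J (x - 2 * Real.pi * t)‖ₑ =
      ENNReal.ofReal (1 / (1 + t ^ 2)) * ∫⁻ x, ‖J x‖ₑ := by
    intro t
    rw [lintegral_const_mul' _ _ ENNReal.ofReal_ne_top,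
      lintegral_sub_right_eq_self (fun x ↦ ‖J x‖ₑ)]
  simp_rw [h1]
  rw [lintegral_mul_const _ (by fun_prop)]
  refine ENNReal.mul_lt_top ?_ hJ.2
  have h2 : Integrable fun t : ℝ ↦ 1 / (1 + t ^ 2) := by simpa using integrable_inv_one_add_sq
  exact h2.lintegral_lt_top

/-! ### Densities from integrable Fourier transforms -/

/-- Inversion for the Schwartz function `f` gives `∫ f dμ` as `𝓕 f` paired with the transform of
`μ`; self-adjointness of `𝓕` then moves it onto the integrable factor. -/
lemma integral_mul_fourier_of_smooth (μ : Measure ℝ) [IsFiniteMeasure μ]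
    (hJ : Integrable (fourierCov μ)) {f : ℝ → ℝ} (hf : ContDiff ℝ (⊤ : ℕ∞) f)
    (hfc : HasCompactSupport f) :
    ∫ ξ, f ξ ∂μ = ∫ ξ, f ξ * (𝓕 (fun t : ℝ ↦ fourierCov μ (-(2 * Real.pi) * t)) ξ).re := by
  have hK : Integrable fun t : ℝ ↦ fourierCov μ (-(2 * Real.pi) * t) :=
    hJ.comp_mul_left' (by simp [Real.pi_ne_zero])
  have hg₁ : HasCompactSupport (Complex.ofRealCLM ∘ f) := hfc.comp_left rfl
  have hg₂ : ContDiff ℝ (⊤ : ℕ∞) (Complex.ofRealCLM ∘ f) := by fun_prop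
  set g : SchwartzMap ℝ ℂ := hg₁.toSchwartzMap hg₂ with hg
  have hgf : ∀ ξ, g ξ = (f ξ : ℂ) := fun ξ ↦ rfl
  have hG : Integrable (𝓕 (g : ℝ → ℂ)) := by
    rw [← SchwartzMap.fourier_coe]
    exact (𝓕 g).integrable
  have hinv : 𝓕⁻ (𝓕 (g : ℝ → ℂ)) = g :=
    Continuous.fourierInv_fourier_eq g.continuous g.integrable hG
  have h := integral_exp_mul_fourierInv μ hG 0
  rw [hinv] at h
  have hflip : ∫ t : ℝ, 𝓕 (g : ℝ → ℂ) t • fourierCov μ (-(2 * Real.pi) * t) =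
      ∫ ξ : ℝ, g ξ • 𝓕 (fun t : ℝ ↦ fourierCov μ (-(2 * Real.pi) * t)) ξ := by
    have := VectorFourier.integral_fourierIntegral_smul_eq_flip (μ := volume) (ν := volume)
      (L := innerₗ ℝ) Real.continuous_fourierChar (by exact continuous_inner) g.integrable hK
    rwa [flip_innerₗ] at this
  have hc : (∫ ξ, (f ξ : ℂ) ∂μ) =
      ∫ ξ, (f ξ : ℂ) * 𝓕 (fun t : ℝ ↦ fourierCov μ (-(2 * Real.pi) * t)) ξ := by
    simp only [hgf, smul_eq_mul] at hflip
    rw [← hflip]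
    simpa [hgf] using h
  have hint : Integrable fun ξ ↦
      (f ξ : ℂ) * 𝓕 (fun t : ℝ ↦ fourierCov μ (-(2 * Real.pi) * t)) ξ := by
    refine Continuous.integrable_of_hasCompactSupport ?_ hg₁.mul_right
    exact (Complex.continuous_ofReal.comp hf.continuous).mul (continuous_fourier_of_integrable hK)
  have h3 := congrArg Complex.re hc
  rw [integral_complex_ofReal, Complex.ofReal_re] at h3
  rw [h3, ← RCLike.re_eq_complex_re, ← integral_re hint]
  simp

lemma tendsto_contDiffBump_indicator_ball {c r : ℝ} (hr : 0 < r) :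
    ∃ f : ℕ → ContDiffBump c, (∀ n, (f n).rOut = r) ∧
      ∀ x, Tendsto (fun n ↦ f n x) atTop (𝓝 ((Metric.ball c r).indicator 1 x)) := by
  have hlt : ∀ n : ℕ, 0 < 1 / ((n : ℝ) + 2) ∧ 1 / ((n : ℝ) + 2) < 1 := fun n ↦
    ⟨by positivity, by rw [div_lt_one (by positivity)]; linarith [n.cast_nonneg (α := ℝ)]⟩
  refine ⟨fun n ↦ ⟨r * (1 - 1 / ((n : ℝ) + 2)), r,
    mul_pos hr (by linarith [hlt n]), by nlinarith [hlt n]⟩, fun n ↦ rfl, fun x ↦ ?_⟩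
  by_cases hx : x ∈ Metric.ball c r
  · rw [Set.indicator_of_mem hx]
    have hlim : Tendsto (fun n : ℕ ↦ r * (1 - 1 / ((n : ℝ) + 2))) atTop (𝓝 (r * (1 - 0))) := by
      refine (tendsto_const_nhds.sub ?_).const_mul r
      exact tendsto_const_nhds.div_atTop
        (tendsto_atTop_add_const_right _ _ tendsto_natCast_atTop_atTop)
    have hx' : dist x c < r * (1 - 0) := by simpa using hx
    refine tendsto_const_nhds.congr' ?_
    filter_upwards [hlim.eventually_const_lt hx'] with n hn
    exact (ContDiffBump.one_of_mem_closedBall _ (by simpa using hn.le)).symm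
  · rw [Set.indicator_of_notMem hx]
    refine tendsto_const_nhds.congr fun n ↦ ?_
    exact (ContDiffBump.zero_of_le_dist _ (by simpa using hx)).symm

lemma nonneg_of_integral_contDiffBump_mul_nonneg {q : ℝ → ℝ} (hq : Continuous q)
    (h : ∀ (c : ℝ) (f : ContDiffBump c), 0 ≤ ∫ ξ, f ξ * q ξ) (x : ℝ) : 0 ≤ q x := by
  by_contra! hx
  obtain ⟨δ, hδ, hball⟩ := Metric.eventually_nhds_iff_ball.1
    (hq.continuousAt.eventually_lt_const hx)
  let f : ContDiffBump x := ⟨δ / 2, δ, by positivity, by linarith⟩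
  have hpos : 0 < ∫ ξ, f ξ * -q ξ := by
    refine Continuous.integral_pos_of_hasCompactSupport_nonneg_nonzero (x := x)
      (f.continuous.mul hq.neg) f.hasCompactSupport.mul_right (fun y ↦ ?_) ?_
    · by_cases hy : y ∈ Metric.ball x δ
      · exact mul_nonneg f.nonneg (by linarith [hball y hy])
      · have : f y = 0 := f.zero_of_le_dist (by simpa using hy)
        simp [this]
    · have : f x = 1 := f.one_of_mem_closedBall (by simp [f.rIn_pos.le])
      simp [this, hx.ne]
  have := h x f
  simp only [mul_neg, integral_neg] at hpos
  linarith

/-- Bumps filling an open interval from inside converge to its indicator under a fixed domination,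
so both measures agree on rational intervals. -/
lemma eq_withDensity_of_integral_contDiffBump (μ : Measure ℝ) [IsFiniteMeasure μ] {q : ℝ → ℝ}
    (hq : Continuous q) (hq0 : ∀ x, 0 ≤ q x)
    (h : ∀ (c : ℝ) (f : ContDiffBump c), ∫ ξ, f ξ ∂μ = ∫ ξ, f ξ * q ξ) :
    μ = volume.withDensity fun x ↦ ENNReal.ofReal (q x) := by
  refine Real.measure_ext_Ioo_rat fun a b ↦ ?_
  rcases le_or_gt (b : ℝ) a with hab | hab
  · simp [Set.Ioo_eq_empty_of_le hab]
  obtain ⟨f, hf, hlim⟩ := tendsto_contDiffBump_indicator_ball (c := ((a : ℝ) + b) / 2)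
    (r := ((b : ℝ) - a) / 2) (by linarith)
  have hball : Metric.ball (((a : ℝ) + b) / 2) (((b : ℝ) - a) / 2) = Set.Ioo (a : ℝ) b := by
    rw [Real.ball_eq_Ioo]
    congr 1 <;> ring
  rw [hball] at hlim
  have hqi : IntegrableOn q (Set.Ioo (a : ℝ) b) :=
    (hq.continuousOn.integrableOn_Icc).mono_set Set.Ioo_subset_Icc_self
  have hle : ∀ n x, ‖f n x‖ ≤ (Set.Ioo (a : ℝ) b).indicator (1 : ℝ → ℝ) x := by
    intro n x
    rw [Real.norm_of_nonneg (f n).nonneg]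
    by_cases hx : x ∈ Set.Ioo (a : ℝ) b
    · rw [Set.indicator_of_mem hx]
      exact (f n).le_one
    · rw [Set.indicator_of_notMem hx]
      rw [← hball] at hx
      exact ((f n).zero_of_le_dist (by simpa [hf n] using hx)).le
  have l1 : Tendsto (fun n ↦ ∫ x, f n x ∂μ) atTop
      (𝓝 (∫ x, (Set.Ioo (a : ℝ) b).indicator (1 : ℝ → ℝ) x ∂μ)) := by
    refine tendsto_integral_of_dominated_convergence _
      (fun n ↦ (f n).continuous.aestronglyMeasurable) ?_ (fun n ↦ .of_forall (hle n))
      (.of_forall hlim)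
    exact (integrable_const (1 : ℝ)).indicator measurableSet_Ioo
  have l2 : Tendsto (fun n ↦ ∫ x, f n x * q x) atTop
      (𝓝 (∫ x, (Set.Ioo (a : ℝ) b).indicator q x)) := by
    refine tendsto_integral_of_dominated_convergence _
      (fun n ↦ ((f n).continuous.mul hq).aestronglyMeasurable)
      (hqi.integrable_indicator measurableSet_Ioo) (fun n ↦ .of_forall fun x ↦ ?_)
      (.of_forall fun x ↦ ?_)
    · rw [norm_mul, Real.norm_of_nonneg (hq0 x)]
      refine (mul_le_mul_of_nonneg_right (hle n x) (hq0 x)).trans_eq ?_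
      by_cases hx : x ∈ Set.Ioo (a : ℝ) b <;> simp [hx]
    · convert (hlim x).mul_const (q x) using 2
      by_cases hx : x ∈ Set.Ioo (a : ℝ) b <;> simp [hx]
  simp_rw [h] at l1
  have heq := tendsto_nhds_unique l1 l2
  rw [integral_indicator_one measurableSet_Ioo, integral_indicator measurableSet_Ioo] at heq
  rw [withDensity_apply _ measurableSet_Ioo,
    ← ofReal_integral_eq_lintegral_ofReal hqi (.of_forall hq0), ← heq, ofReal_measureReal]

/-- A finite measure on `ℝ` with integrable Fourier transform has a bounded continuous density. -/
lemma hasBoundedContinuousDensity_of_integrable (μ : Measure ℝ) [IsFiniteMeasure μ]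
    (hJ : Integrable (fourierCov μ)) : HasBoundedContinuousDensity μ := by
  have hK : Integrable fun t : ℝ ↦ fourierCov μ (-(2 * Real.pi) * t) :=
    hJ.comp_mul_left' (by simp [Real.pi_ne_zero])
  set q : ℝ → ℝ := fun ξ ↦ (𝓕 (fun t : ℝ ↦ fourierCov μ (-(2 * Real.pi) * t)) ξ).re with hqdef
  have hq : Continuous q := Complex.continuous_re.comp (continuous_fourier_of_integrable hK)
  have h : ∀ (c : ℝ) (f : ContDiffBump c), ∫ ξ, f ξ ∂μ = ∫ ξ, f ξ * q ξ := fun c f ↦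
    integral_mul_fourier_of_smooth μ hJ f.contDiff f.hasCompactSupport
  have hq0 : ∀ x, 0 ≤ q x := nonneg_of_integral_contDiffBump_mul_nonneg hq fun c f ↦ by
    rw [← h]
    exact integral_nonneg fun _ ↦ f.nonneg
  refine ⟨q, hq, hq0, ⟨∫ t : ℝ, ‖fourierCov μ (-(2 * Real.pi) * t)‖, fun x ↦ ?_⟩,
    eq_withDensity_of_integral_contDiffBump μ hq hq0 h⟩
  refine (Complex.re_le_norm _).trans ?_
  rw [Real.fourier_real_eq]
  exact (norm_integral_le_integral_norm _).trans_eq (by simp [Circle.norm_smul])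

/-! ### Exponential tilting -/

/-- The measure `cosh(c ξ) dρ(ξ)`. -/
noncomputable def coshTilt (ρ : Measure ℝ) (c : ℝ) : Measure ℝ :=
  ρ.withDensity fun ξ ↦ ENNReal.ofReal (Real.cosh (c * ξ))

lemma integral_coshTilt (ρ : Measure ℝ) (c : ℝ) (f : ℝ → ℂ) :
    ∫ ξ, f ξ ∂coshTilt ρ c = ∫ ξ, (Real.cosh (c * ξ) : ℂ) * f ξ ∂ρ := by
  rw [coshTilt, integral_withDensity_eq_integral_toReal_smul (by fun_prop) (by simp)]
  refine integral_congr_ae (.of_forall fun ξ ↦ ?_)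
  simp only [ENNReal.toReal_ofReal (Real.cosh_pos _).le, Complex.real_smul]

lemma isFiniteMeasure_coshTilt {ρ : Measure ℝ} {c : ℝ}
    (h : Integrable (fun ξ ↦ Real.cosh (c * ξ)) ρ) : IsFiniteMeasure (coshTilt ρ c) :=
  isFiniteMeasure_withDensity_ofReal h.2

lemma hasBoundedContinuousDensity_of_coshTilt {ρ : Measure ℝ} {c : ℝ}
    (h : HasBoundedContinuousDensity (coshTilt ρ c)) : HasBoundedContinuousDensity ρ := by
  obtain ⟨p, hp, hp0, ⟨C, hC⟩, heq⟩ := h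
  have hcont : Continuous fun ξ : ℝ ↦ Real.cosh (c * ξ) := by fun_prop
  refine ⟨fun ξ ↦ p ξ / Real.cosh (c * ξ), hp.div hcont fun ξ ↦ (Real.cosh_pos _).ne',
    fun ξ ↦ div_nonneg (hp0 ξ) (Real.cosh_pos _).le,
    ⟨C, fun ξ ↦ (div_le_self (hp0 ξ) (Real.one_le_cosh _)).trans (hC ξ)⟩, ?_⟩
  have h1 : ρ = (coshTilt ρ c).withDensity
      fun ξ ↦ (ENNReal.ofReal (Real.cosh (c * ξ)))⁻¹ := by
    rw [coshTilt, withDensity_inv_same (by fun_prop) (.of_forall fun ξ ↦ by simp [Real.cosh_pos])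
      (.of_forall fun ξ ↦ by simp)]
  rw [h1, heq, ← withDensity_mul _ (by fun_prop) (by fun_prop)]
  congr 1
  ext ξ
  rw [Pi.mul_apply, ← ENNReal.ofReal_inv_of_pos (Real.cosh_pos _),
    ← ENNReal.ofReal_mul (hp0 ξ), ← div_eq_mul_inv]

lemma noAtoms_of_hasBoundedContinuousDensity {ρ : Measure ℝ} (h : HasBoundedContinuousDensity ρ)
    (x : ℝ) : ρ {x} = 0 := by
  obtain ⟨p, -, -, -, rfl⟩ := h
  exact withDensity_absolutelyContinuous _ _ (measure_singleton x)

/-! ### Symmetric measures -/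

lemma fourierCov_eq_charFun (ρ : Measure ℝ) (t : ℝ) : fourierCov ρ t = charFun ρ (-t) := by
  rw [charFun_apply_real, fourierCov]
  refine integral_congr_ae (.of_forall fun ξ ↦ ?_)
  simp only [Complex.ofReal_neg]
  congr 1
  ring

/-- Reflection conjugates the characteristic function, and a real one is fixed by conjugation. -/
lemma map_neg_eq_of_fourierCov_real {ρ : Measure ℝ} [IsFiniteMeasure ρ] {r : ℝ → ℝ}
    (h : ∀ t, (r t : ℂ) = fourierCov ρ t) : ρ.map Neg.neg = ρ := by
  refine Measure.ext_of_charFun (funext fun t ↦ ?_)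
  have h1 : charFun (ρ.map Neg.neg) t = charFun ρ (-t) := by
    rw [charFun_apply_real, charFun_apply_real, integral_map (by fun_prop) (by fun_prop)]
    simp
  rw [h1, charFun_neg, ← neg_neg t, ← fourierCov_eq_charFun, ← h, Complex.conj_ofReal]

lemma fourierCov_coshTilt {ρ : Measure ℝ} [IsFiniteMeasure ρ] (hsymm : ρ.map Neg.neg = ρ)
    {κo : ℝ} (hint : Integrable (fun ξ ↦ Real.cosh (2 * κo * ξ)) ρ) (t : ℝ) :
    fourierCov (coshTilt ρ (2 * κo)) t = (rTilted ρ κo t : ℂ) := by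
  have i1 : Integrable (fun ξ ↦ Real.cos (t * ξ) * Real.cosh (2 * κo * ξ)) ρ :=
    hint.bdd_mul (c := 1) (by fun_prop) (.of_forall fun ξ ↦ Real.abs_cos_le_one _)
  have i2 : Integrable (fun ξ ↦ Real.sin (t * ξ) * Real.cosh (2 * κo * ξ)) ρ :=
    hint.bdd_mul (c := 1) (by fun_prop) (.of_forall fun ξ ↦ Real.abs_sin_le_one _)
  have hodd : ∫ ξ, Real.sin (t * ξ) * Real.cosh (2 * κo * ξ) ∂ρ = 0 := by
    have h := integral_map (μ := ρ) (φ := Neg.neg)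
      (f := fun ξ ↦ Real.sin (t * ξ) * Real.cosh (2 * κo * ξ)) (by fun_prop) (by fun_prop)
    rw [hsymm] at h
    simp only [mul_neg, Real.sin_neg, Real.cosh_neg, neg_mul, integral_neg] at h
    linarith
  rw [fourierCov, integral_coshTilt, rTilted]
  have h1 : ∀ ξ : ℝ, (Real.cosh (2 * κo * ξ) : ℂ) *
      Complex.exp (-Complex.I * (ξ : ℂ) * (t : ℂ)) =
      ((Real.cos (t * ξ) * Real.cosh (2 * κo * ξ) : ℝ) : ℂ) -
        Complex.I * ((Real.sin (t * ξ) * Real.cosh (2 * κo * ξ) : ℝ) : ℂ) := by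
    intro ξ
    rw [show -Complex.I * (ξ : ℂ) * (t : ℂ) = ((-(t * ξ) : ℝ) : ℂ) * Complex.I by push_cast; ring,
      Complex.exp_mul_I, ← Complex.ofReal_cos, ← Complex.ofReal_sin, Real.cos_neg, Real.sin_neg]
    push_cast
    ring
  simp_rw [h1]
  rw [integral_sub i1.ofReal (i2.ofReal.const_mul _), integral_const_mul,
    integral_complex_ofReal, integral_complex_ofReal, hodd]
  simp

/-! ### Compactly supported spectral measures -/

lemma exists_ae_abs_le_of_isCompact_support {ρ : Measure ℝ} (h : IsCompact ρ.support) :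
    ∃ R : ℝ, 0 < R ∧ ∀ᵐ ξ ∂ρ, |ξ| ≤ R := by
  obtain ⟨R, hR, hsub⟩ := h.isBounded.subset_closedBall_lt 0 0
  refine ⟨R, hR, ?_⟩
  filter_upwards [Measure.support_mem_ae (μ := ρ)] with ξ hξ
  simpa using hsub hξ

lemma expMoment_of_isCompact_support {ρ : Measure ℝ} [IsFiniteMeasure ρ]
    (h : IsCompact ρ.support) {κ : ℝ} (hκ : 0 < κ) : ExpMoment ρ κ := by
  obtain ⟨R, -, hae⟩ := exists_ae_abs_le_of_isCompact_support h
  refine Integrable.of_bound (C := Real.exp (R * κ)) (by fun_prop) ?_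
  filter_upwards [hae] with ξ hξ
  rw [Real.norm_of_nonneg (Real.exp_pos _).le]
  gcongr

/-- A cutoff equal to 1 on the support turns `cosh` into a `C²` multiplier with compact support
without changing the integral against `ρ`. -/
lemma integrable_fourierCov_coshTilt_of_isCompact_support {ρ : Measure ℝ} [IsFiniteMeasure ρ]
    (h : IsCompact ρ.support) (hJ : Integrable (fourierCov ρ)) (c : ℝ)
    (hint : Integrable (fun ξ ↦ Real.cosh (c * ξ)) ρ) :
    Integrable (fourierCov (coshTilt ρ c)) := by
  obtain ⟨R, hR, hae⟩ := exists_ae_abs_le_of_isCompact_support h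
  have := isFiniteMeasure_coshTilt hint
  let f : ContDiffBump (0 : ℝ) := ⟨R, R + 1, hR, by linarith⟩
  let m : ℝ → ℂ := fun ξ ↦ ((f ξ * Real.cosh (c * ξ) : ℝ) : ℂ)
  have hm : ContDiff ℝ 3 m := by
    have h1 : ContDiff ℝ 3 (f : ℝ → ℝ) := f.contDiff
    have h2 : ContDiff ℝ 3 fun ξ : ℝ ↦ f ξ * Real.cosh (c * ξ) := by fun_prop
    exact Complex.ofRealCLM.contDiff.comp h2
  have hmc : HasCompactSupport m := by
    have h1 : HasCompactSupport fun ξ : ℝ ↦ f ξ * Real.cosh (c * ξ) := f.hasCompactSupport.mul_right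
    exact h1.comp_left Complex.ofReal_zero
  have hm' : ContDiff ℝ 2 (deriv m) := ((contDiff_succ_iff_deriv (n := 2)).1 hm).2.2
  have hm'' : ContDiff ℝ 1 (deriv (deriv m)) := ((contDiff_succ_iff_deriv (n := 1)).1 hm').2.2
  have key := enorm_integral_exp_mul_le ρ (m := m) (m' := deriv m) (m'' := deriv (deriv m))
    (fun ξ ↦ (hm.differentiable (by norm_num) ξ).hasDerivAt)
    (fun ξ ↦ (hm'.differentiable (by norm_num) ξ).hasDerivAt)
    (hm.continuous.integrable_of_hasCompactSupport hmc)
    (hm'.continuous.integrable_of_hasCompactSupport hmc.deriv)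
    (hm''.continuous.integrable_of_hasCompactSupport hmc.deriv.deriv) le_rfl
  refine ⟨(continuous_fourierCov _).aestronglyMeasurable, ?_⟩
  refine (lintegral_mono fun x ↦ (?_ : _ ≤ _)).trans_lt (?_ : ∫⁻ x, ENNReal.ofReal
    ((∫ ξ, ‖m ξ‖) + ∫ ξ, ‖deriv (deriv m) ξ‖) * majorant (fourierCov ρ) x < ∞)
  · refine le_of_eq_of_le ?_ (key x)
    rw [fourierCov, integral_coshTilt]
    congr 1
    refine integral_congr_ae ?_
    filter_upwards [hae] with ξ hξ
    have hf : f ξ = 1 := f.one_of_mem_closedBall (by simpa using hξ)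
    simp only [m, hf, one_mul]
    ring
  · rw [lintegral_const_mul' _ _ ENNReal.ofReal_ne_top]
    exact ENNReal.mul_lt_top ENNReal.ofReal_lt_top
      (lintegral_majorant_lt_top hJ (continuous_fourierCov ρ).measurable)

/-! ### Exponential multipliers -/

lemma one_add_sq_sq_le_exp {c : ℝ} (hc : 0 < c) (ξ : ℝ) :
    (1 + ξ ^ 2) ^ 2 ≤ (2 + 48 / c ^ 4) * Real.exp (c * |ξ|) := by
  have h1 := Real.pow_div_factorial_le_exp (c * |ξ|) (by positivity) 4
  have h2 := Real.one_le_exp (by positivity : 0 ≤ c * |ξ|)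
  rw [mul_pow, (by decide : Even 4).pow_abs, div_le_iff₀ (by positivity)] at h1
  norm_num [Nat.factorial] at h1
  have h3 : ξ ^ 4 ≤ 24 / c ^ 4 * Real.exp (c * |ξ|) := by
    rw [div_mul_eq_mul_div, le_div_iff₀ (by positivity)]
    linarith
  have h4 : 48 / c ^ 4 = 2 * (24 / c ^ 4) := by ring
  rw [h4]
  nlinarith [sq_nonneg (ξ ^ 2 - 1)]

lemma exp_abs_le_two_mul_cosh (v : ℝ) : Real.exp |v| ≤ 2 * Real.cosh v := by
  rw [← Real.cosh_abs, Real.cosh_eq]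
  linarith [Real.exp_pos (-|v|)]

lemma cosh_le_exp_abs (v : ℝ) : Real.cosh v ≤ Real.exp |v| := by
  rw [← Real.cosh_abs, Real.cosh_eq]
  have : Real.exp (-|v|) ≤ Real.exp |v| := Real.exp_le_exp.2 (by linarith [abs_nonneg v])
  linarith

/-- Since `|2a| ≤ c/2`, half of the decay of `1 / cosh(cξ)` absorbs the exponential; the other half
beats `(1 + ξ²)²`. -/
lemma exp_div_cosh_le {c a : ℝ} (hc : 0 < c) (ha : |a| ≤ c / 4) (ξ : ℝ) :
    (1 + ξ ^ 2) * (Real.exp (2 * a * ξ) / Real.cosh (c * ξ)) ≤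
      2 * (2 + 48 / (c / 2) ^ 4) * (1 + ξ ^ 2)⁻¹ := by
  have h1 := one_add_sq_sq_le_exp (half_pos hc) ξ
  have h2 : Real.exp (2 * a * ξ) ≤ Real.exp (c / 2 * |ξ|) := by
    refine Real.exp_le_exp.2 ((le_abs_self _).trans ?_)
    rw [abs_mul, abs_mul, abs_two]
    gcongr
    linarith
  have h3 : Real.exp (c / 2 * |ξ|) * Real.exp (c / 2 * |ξ|) ≤ 2 * Real.cosh (c * ξ) := by
    have := exp_abs_le_two_mul_cosh (c * ξ)
    rw [abs_mul, abs_of_pos hc] at this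
    rw [← Real.exp_add]
    convert this using 2
    ring
  have hE := Real.exp_pos (c / 2 * |ξ|)
  rw [← mul_div_assoc, div_le_iff₀ (Real.cosh_pos _), ← div_eq_mul_inv, div_mul_eq_mul_div,
    le_div_iff₀ (by positivity)]
  set K := 2 + 48 / (c / 2) ^ 4 with hK
  have hK0 : 0 < K := by positivity
  calc (1 + ξ ^ 2) * Real.exp (2 * a * ξ) * (1 + ξ ^ 2)
      = (1 + ξ ^ 2) ^ 2 * Real.exp (2 * a * ξ) := by ring
    _ ≤ (K * Real.exp (c / 2 * |ξ|)) * Real.exp (c / 2 * |ξ|) := by gcongr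
    _ = K * (Real.exp (c / 2 * |ξ|) * Real.exp (c / 2 * |ξ|)) := by ring
    _ ≤ K * (2 * Real.cosh (c * ξ)) := by gcongr
    _ = 2 * K * Real.cosh (c * ξ) := by ring

/-- A `C²` weight `p` which, with two derivatives, grows at most quadratically. -/
structure QuadraticGrowth (p p' p'' : ℝ → ℝ) : Prop where
  hasDerivAt : ∀ ξ, HasDerivAt p (p' ξ) ξ
  hasDerivAt' : ∀ ξ, HasDerivAt p' (p'' ξ) ξ
  continuous'' : Continuous p''
  bound : ∀ ξ, |p ξ| ≤ 2 * (1 + ξ ^ 2)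
  bound' : ∀ ξ, |p' ξ| ≤ 2 * (1 + ξ ^ 2)
  bound'' : ∀ ξ, |p'' ξ| ≤ 2 * (1 + ξ ^ 2)

lemma QuadraticGrowth.continuous {p p' p'' : ℝ → ℝ} (h : QuadraticGrowth p p' p'') :
    Continuous p := continuous_iff_continuousAt.2 fun ξ ↦ (h.hasDerivAt ξ).continuousAt

lemma QuadraticGrowth.continuous' {p p' p'' : ℝ → ℝ} (h : QuadraticGrowth p p' p'') :
    Continuous p' := continuous_iff_continuousAt.2 fun ξ ↦ (h.hasDerivAt' ξ).continuousAt

lemma quadraticGrowth_one : QuadraticGrowth (fun _ ↦ 1) (fun _ ↦ 0) (fun _ ↦ 0) where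
  hasDerivAt ξ := hasDerivAt_const _ _
  hasDerivAt' ξ := hasDerivAt_const _ _
  continuous'' := continuous_const
  bound ξ := by rw [abs_one]; nlinarith [sq_nonneg ξ]
  bound' ξ := by rw [abs_zero]; positivity
  bound'' ξ := by rw [abs_zero]; positivity

lemma quadraticGrowth_id : QuadraticGrowth (fun ξ ↦ ξ) (fun _ ↦ 1) (fun _ ↦ 0) where
  hasDerivAt ξ := hasDerivAt_id' _
  hasDerivAt' ξ := hasDerivAt_const _ _
  continuous'' := continuous_const
  bound ξ := by rw [abs_le]; constructor <;> nlinarith [sq_nonneg (ξ - 1), sq_nonneg (ξ + 1)]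
  bound' ξ := by rw [abs_one]; nlinarith [sq_nonneg ξ]
  bound'' ξ := by rw [abs_zero]; positivity

lemma quadraticGrowth_sq : QuadraticGrowth (fun ξ ↦ ξ ^ 2) (fun ξ ↦ 2 * ξ) (fun _ ↦ 2) where
  hasDerivAt ξ := by simpa using hasDerivAt_pow 2 ξ
  hasDerivAt' ξ := by simpa using (hasDerivAt_id' ξ).const_mul 2
  continuous'' := continuous_const
  bound ξ := by rw [abs_le]; constructor <;> nlinarith [sq_nonneg ξ]
  bound' ξ := by rw [abs_le]; constructor <;> nlinarith [sq_nonneg (ξ - 1), sq_nonneg (ξ + 1)]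
  bound'' ξ := by rw [abs_two]; nlinarith [sq_nonneg ξ]

/-- The quotient `u` of exponential by `cosh` satisfies `u' = w u` with `w = 2a - c tanh(cξ)`. As
`w` and `w'` are bounded uniformly in `a`, differentiating `p u` only changes the quadratically
growing factor in front of `u`. -/
lemma exists_exp_multiplier_bound {c : ℝ} (hc : 0 < c) :
    ∃ B : ℝ, ∀ (p p' p'' : ℝ → ℝ), QuadraticGrowth p p' p'' → ∀ a : ℝ, |a| ≤ c / 4 →
      ∀ (μ : Measure ℝ) [IsFiniteMeasure μ] (x : ℝ),
        ‖∫ ξ : ℝ, Complex.exp (-Complex.I * (ξ : ℂ) * (x : ℂ)) *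
          ((p ξ * (Real.exp (2 * a * ξ) / Real.cosh (c * ξ)) : ℝ) : ℂ) ∂μ‖ₑ ≤
        ENNReal.ofReal B * majorant (fourierCov μ) x := by
  set K := 2 * (2 + 48 / (c / 2) ^ 4) with hK
  have hK0 : 0 < K := by positivity
  -- `D` is what the second derivative needs, from `|w| ≤ 2c`, `|w'| ≤ c²` and the factor 2 in
  -- `QuadraticGrowth`; it also covers the lower orders.
  set D := 2 * (1 + 4 * c + 5 * c ^ 2) with hD
  have hD0 : 0 < D := by positivity
  have hdom : Integrable fun ξ : ℝ ↦ D * (K * (1 + ξ ^ 2)⁻¹) :=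
    (integrable_inv_one_add_sq.const_mul K).const_mul D
  refine ⟨2 * ∫ ξ : ℝ, D * (K * (1 + ξ ^ 2)⁻¹), fun p p' p'' hp a ha μ _ x ↦ ?_⟩
  let u : ℝ → ℝ := fun ξ ↦ Real.exp (2 * a * ξ) / Real.cosh (c * ξ)
  let w : ℝ → ℝ := fun ξ ↦ 2 * a - c * (Real.sinh (c * ξ) / Real.cosh (c * ξ))
  let w' : ℝ → ℝ := fun ξ ↦ -(c ^ 2 / Real.cosh (c * ξ) ^ 2)
  have hch : ∀ ξ, Real.cosh (c * ξ) ≠ 0 := fun ξ ↦ (Real.cosh_pos _).ne'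
  have hlin : ∀ b ξ : ℝ, HasDerivAt (fun ξ : ℝ ↦ b * ξ) b ξ := fun b ξ ↦ by
    simpa using (hasDerivAt_id' ξ).const_mul b
  have hu : ∀ ξ, HasDerivAt u (w ξ * u ξ) ξ := fun ξ ↦ by
    refine ((hlin (2 * a) ξ).exp.div (hlin c ξ).cosh (hch ξ)).congr_deriv ?_
    have := hch ξ
    simp only [u, w]
    field_simp
  have hw : ∀ ξ, HasDerivAt w (w' ξ) ξ := fun ξ ↦ by
    refine ((((hlin c ξ).sinh.div (hlin c ξ).cosh (hch ξ)).const_mul c).const_sub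
      (2 * a)).congr_deriv ?_
    have := hch ξ
    have h2 := Real.cosh_sq (c * ξ)
    simp only [w']
    field_simp
    linear_combination -h2
  have hu0 : ∀ ξ, 0 ≤ u ξ := fun ξ ↦ div_nonneg (Real.exp_pos _).le (Real.cosh_pos _).le
  have hwb : ∀ ξ, |w ξ| ≤ 2 * c := fun ξ ↦ by
    have h1 : |Real.sinh (c * ξ) / Real.cosh (c * ξ)| ≤ 1 := by
      rw [abs_div, abs_of_pos (Real.cosh_pos _), div_le_one (Real.cosh_pos _)]
      refine abs_le_of_sq_le_sq ?_ (Real.cosh_pos _).le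
      linarith [Real.cosh_sq (c * ξ)]
    have h3 := abs_le.1 h1
    have h4 := abs_le.1 ha
    simp only [w]
    rw [abs_le]
    constructor <;> nlinarith
  have hwb' : ∀ ξ, |w' ξ| ≤ c ^ 2 := fun ξ ↦ by
    simp only [w']
    rw [abs_neg, abs_of_nonneg (by positivity)]
    exact div_le_self (by positivity) (one_le_pow₀ (Real.one_le_cosh _))
  have hdom' : ∀ (e : ℝ) ξ, |e| ≤ D * (1 + ξ ^ 2) →
      ‖((e * u ξ : ℝ) : ℂ)‖ ≤ D * (K * (1 + ξ ^ 2)⁻¹) := by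
    intro e ξ he
    rw [Complex.norm_real, norm_mul, Real.norm_of_nonneg (hu0 ξ), Real.norm_eq_abs]
    have := exp_div_cosh_le hc ha ξ
    calc |e| * u ξ ≤ D * (1 + ξ ^ 2) * u ξ := mul_le_mul_of_nonneg_right he (hu0 ξ)
      _ = D * ((1 + ξ ^ 2) * u ξ) := by ring
      _ ≤ _ := by gcongr
  let e0 : ℝ → ℝ := p
  let e1 : ℝ → ℝ := fun ξ ↦ p' ξ + p ξ * w ξ
  let e2 : ℝ → ℝ := fun ξ ↦ p'' ξ + (p' ξ * w ξ + p ξ * w' ξ) + e1 ξ * w ξ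
  have hpw : ∀ ξ, |p ξ * w ξ| ≤ 2 * (1 + ξ ^ 2) * (2 * c) := fun ξ ↦ by
    rw [abs_mul]; gcongr; exacts [hp.bound ξ, hwb ξ]
  have hpw' : ∀ ξ, |p' ξ * w ξ| ≤ 2 * (1 + ξ ^ 2) * (2 * c) := fun ξ ↦ by
    rw [abs_mul]; gcongr; exacts [hp.bound' ξ, hwb ξ]
  have hpw'' : ∀ ξ, |p ξ * w' ξ| ≤ 2 * (1 + ξ ^ 2) * c ^ 2 := fun ξ ↦ by
    rw [abs_mul]; gcongr; exacts [hp.bound ξ, hwb' ξ]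
  have be0 : ∀ ξ, |e0 ξ| ≤ D * (1 + ξ ^ 2) := fun ξ ↦ by
    refine (hp.bound ξ).trans ?_
    gcongr
    rw [hD]; nlinarith [sq_nonneg c]
  have be1' : ∀ ξ, |e1 ξ| ≤ 2 * (1 + ξ ^ 2) * (1 + 2 * c) := fun ξ ↦
    (abs_add_le _ _).trans (by linarith [hp.bound' ξ, hpw ξ])
  have be1 : ∀ ξ, |e1 ξ| ≤ D * (1 + ξ ^ 2) := fun ξ ↦ by
    refine (be1' ξ).trans ?_
    rw [mul_right_comm]
    gcongr
    rw [hD]; nlinarith [sq_nonneg c]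
  have be2 : ∀ ξ, |e2 ξ| ≤ D * (1 + ξ ^ 2) := fun ξ ↦ by
    have h1 : |e1 ξ * w ξ| ≤ 2 * (1 + ξ ^ 2) * (1 + 2 * c) * (2 * c) := by
      rw [abs_mul]; gcongr; exacts [be1' ξ, hwb ξ]
    refine (abs_add_three _ _ _).trans ?_
    have h2 := abs_add_le (p' ξ * w ξ) (p ξ * w' ξ)
    have h3 := hp.bound'' ξ
    have h4 := hpw' ξ
    have h5 := hpw'' ξ
    have h6 : D * (1 + ξ ^ 2) = 2 * (1 + ξ ^ 2) + (2 * (1 + ξ ^ 2) * (2 * c) +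
      2 * (1 + ξ ^ 2) * c ^ 2) + 2 * (1 + ξ ^ 2) * (1 + 2 * c) * (2 * c) := by
      rw [hD]; ring
    linarith
  have he1 : ∀ ξ, HasDerivAt e1 (p'' ξ + (p' ξ * w ξ + p ξ * w' ξ)) ξ := fun ξ ↦
    (hp.hasDerivAt' ξ).add ((hp.hasDerivAt ξ).mul (hw ξ))
  have hd0 : ∀ ξ, HasDerivAt (fun ξ ↦ ((e0 ξ * u ξ : ℝ) : ℂ)) ((e1 ξ * u ξ : ℝ) : ℂ) ξ := fun ξ ↦
    ((hp.hasDerivAt ξ).mul (hu ξ)).ofReal_comp.congr_deriv (by simp only [e1]; push_cast; ring)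
  have hd1 : ∀ ξ, HasDerivAt (fun ξ ↦ ((e1 ξ * u ξ : ℝ) : ℂ)) ((e2 ξ * u ξ : ℝ) : ℂ) ξ := fun ξ ↦
    ((he1 ξ).mul (hu ξ)).ofReal_comp.congr_deriv (by simp only [e2]; push_cast; ring)
  have cu : Continuous u := continuous_iff_continuousAt.2 fun ξ ↦ (hu ξ).continuousAt
  have cw : Continuous w := continuous_iff_continuousAt.2 fun ξ ↦ (hw ξ).continuousAt
  have cw' : Continuous w' := by
    simp only [w']
    fun_prop (disch := exact fun _ ↦ pow_ne_zero _ (hch _))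
  have c0 := hp.continuous
  have c1 := hp.continuous'
  have c2 := hp.continuous''
  have i : ∀ e : ℝ → ℝ, Continuous e → (∀ ξ, |e ξ| ≤ D * (1 + ξ ^ 2)) →
      Integrable (fun ξ ↦ ((e ξ * u ξ : ℝ) : ℂ)) ∧
        ∫ ξ, ‖((e ξ * u ξ : ℝ) : ℂ)‖ ≤ ∫ ξ : ℝ, D * (K * (1 + ξ ^ 2)⁻¹) := by
    intro e ce be
    have h : Integrable (fun ξ ↦ ((e ξ * u ξ : ℝ) : ℂ)) :=
      hdom.mono' (by fun_prop) (.of_forall fun ξ ↦ hdom' _ ξ (be ξ))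
    exact ⟨h, integral_mono h.norm hdom fun ξ ↦ hdom' _ ξ (be ξ)⟩
  have i0 := i e0 c0 be0
  have i1 := i e1 (by fun_prop) be1
  have i2 := i e2 (by fun_prop) be2
  exact enorm_integral_exp_mul_le μ hd0 hd1 i0.1 i1.1 i2.1 (by linarith [i0.2, i2.2]) x

/-! ### Weighted Fourier transforms and their derivatives -/

/-- `x ↦ ∫ e^{-i ξ x} g(ξ) dρ(ξ)`. -/
noncomputable def weightedFourier (ρ : Measure ℝ) (g : ℝ → ℝ) (x : ℝ) : ℂ :=
  ∫ ξ : ℝ, Complex.exp (-Complex.I * (ξ : ℂ) * (x : ℂ)) * (g ξ : ℂ) ∂ρ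

lemma aestronglyMeasurable_exp_mul {ρ : Measure ℝ} {g : ℝ → ℝ} (hg : AEStronglyMeasurable g ρ)
    (x : ℝ) : AEStronglyMeasurable
      (fun ξ : ℝ ↦ Complex.exp (-Complex.I * (ξ : ℂ) * (x : ℂ)) * (g ξ : ℂ)) ρ :=
  (by fun_prop : Continuous fun ξ : ℝ ↦
    Complex.exp (-Complex.I * (ξ : ℂ) * (x : ℂ))).aestronglyMeasurable.mul
    (Complex.continuous_ofReal.comp_aestronglyMeasurable hg)

lemma continuous_weightedFourier {ρ : Measure ℝ} {g : ℝ → ℝ} (hg : Integrable g ρ) :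
    Continuous (weightedFourier ρ g) := by
  refine continuous_of_dominated (bound := fun ξ ↦ |g ξ|)
    (fun x ↦ aestronglyMeasurable_exp_mul hg.1 x)
    (fun x ↦ .of_forall fun ξ ↦ ?_) hg.abs (.of_forall fun ξ ↦ by fun_prop)
  rw [norm_mul, norm_exp_neg_I_mul, one_mul, Complex.norm_real, Real.norm_eq_abs]

lemma hasDerivAt_weightedFourier {ρ : Measure ℝ} {g : ℝ → ℝ} (hg : Integrable g ρ)
    (hg' : Integrable (fun ξ ↦ ξ * g ξ) ρ) (x : ℝ) :
    HasDerivAt (weightedFourier ρ g) (-Complex.I * weightedFourier ρ (fun ξ ↦ ξ * g ξ) x) x := by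
  have hI : -Complex.I * weightedFourier ρ (fun ξ ↦ ξ * g ξ) x =
      ∫ ξ : ℝ, -Complex.I * (Complex.exp (-Complex.I * (ξ : ℂ) * (x : ℂ)) *
        ((ξ * g ξ : ℝ) : ℂ)) ∂ρ := by
    rw [integral_const_mul]
    rfl
  rw [hI]
  have hint : Integrable (fun ξ : ℝ ↦ Complex.exp (-Complex.I * (ξ : ℂ) * (x : ℂ)) *
      (g ξ : ℂ)) ρ :=
    hg.abs.mono' (aestronglyMeasurable_exp_mul hg.1 x) (.of_forall fun ξ ↦ by
      rw [norm_mul, norm_exp_neg_I_mul, one_mul, Complex.norm_real, Real.norm_eq_abs])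
  refine (hasDerivAt_integral_of_dominated_loc_of_deriv_le (𝕜 := ℝ) (s := Set.univ)
    (bound := fun ξ ↦ |ξ * g ξ|)
    (F := fun (x : ℝ) (ξ : ℝ) ↦ Complex.exp (-Complex.I * (ξ : ℂ) * (x : ℂ)) * (g ξ : ℂ))
    (F' := fun (x : ℝ) (ξ : ℝ) ↦ -Complex.I * (Complex.exp (-Complex.I * (ξ : ℂ) * (x : ℂ)) *
        ((ξ * g ξ : ℝ) : ℂ)))
    univ_mem (.of_forall fun x ↦ aestronglyMeasurable_exp_mul hg.1 x) hint
    ((aestronglyMeasurable_exp_mul hg'.1 x).const_mul _) (.of_forall fun ξ x _ ↦ ?_) hg'.abs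
    (.of_forall fun ξ x _ ↦ ?_)).2
  · rw [norm_mul, norm_neg, Complex.norm_I, one_mul, norm_mul, norm_exp_neg_I_mul, one_mul,
      Complex.norm_real, Real.norm_eq_abs]
  · have h1 : HasDerivAt (fun x : ℝ ↦ -Complex.I * (ξ : ℂ) * (x : ℂ)) (-Complex.I * (ξ : ℂ)) x := by
      simpa using (hasDerivAt_id' x).ofReal_comp.const_mul (-Complex.I * (ξ : ℂ))
    exact (h1.cexp.mul_const (g ξ : ℂ)).congr_deriv (by push_cast; ring)

lemma deriv_weightedFourier {ρ : Measure ℝ} {g : ℝ → ℝ} (hg : Integrable g ρ)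
    (hg' : Integrable (fun ξ ↦ ξ * g ξ) ρ) :
    deriv (weightedFourier ρ g) =
      fun x ↦ -Complex.I * weightedFourier ρ (fun ξ ↦ ξ * g ξ) x :=
  funext fun x ↦ (hasDerivAt_weightedFourier hg hg' x).deriv

lemma contDiff_one_weightedFourier {ρ : Measure ℝ} {g : ℝ → ℝ} (hg : Integrable g ρ)
    (hg' : Integrable (fun ξ ↦ ξ * g ξ) ρ) : ContDiff ℝ 1 (weightedFourier ρ g) := by
  rw [contDiff_one_iff_deriv, deriv_weightedFourier hg hg']
  exact ⟨fun x ↦ (hasDerivAt_weightedFourier hg hg' x).differentiableAt,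
    continuous_const.mul (continuous_weightedFourier hg')⟩

lemma contDiff_two_weightedFourier {ρ : Measure ℝ} {g : ℝ → ℝ} (hg : Integrable g ρ)
    (hg' : Integrable (fun ξ ↦ ξ * g ξ) ρ) (hg'' : Integrable (fun ξ ↦ ξ * (ξ * g ξ)) ρ) :
    ContDiff ℝ 2 (weightedFourier ρ g) := by
  rw [show (2 : WithTop ℕ∞) = 1 + 1 by norm_num, contDiff_succ_iff_deriv,
    deriv_weightedFourier hg hg']
  exact ⟨fun x ↦ (hasDerivAt_weightedFourier hg hg' x).differentiableAt, by simp,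
    contDiff_const.mul (contDiff_one_weightedFourier hg' hg'')⟩

lemma iteratedDeriv_two_weightedFourier {ρ : Measure ℝ} {g : ℝ → ℝ} (hg : Integrable g ρ)
    (hg' : Integrable (fun ξ ↦ ξ * g ξ) ρ) (hg'' : Integrable (fun ξ ↦ ξ * (ξ * g ξ)) ρ) :
    iteratedDeriv 2 (weightedFourier ρ g) =
      fun x ↦ -weightedFourier ρ (fun ξ ↦ ξ ^ 2 * g ξ) x := by
  rw [iteratedDeriv_succ, iteratedDeriv_one, deriv_weightedFourier hg hg']
  funext x
  rw [((hasDerivAt_weightedFourier hg' hg'' x).const_mul (-Complex.I)).deriv, ← mul_assoc,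
    neg_mul_neg, Complex.I_mul_I, neg_one_mul]
  simp only [sq, mul_assoc]

/-! ### Integral representations of `sinhc` -/

/-- `∫₀¹ w(s) cosh(2 v s) ds`. -/
noncomputable def coshAverage (w : ℝ → ℝ) (v : ℝ) : ℝ :=
  ∫ s in (0 : ℝ)..1, w s * Real.cosh (2 * v * s)

lemma sinhc_two_mul_eq_coshAverage (v : ℝ) : sinhc (2 * v) = coshAverage (fun _ ↦ 1) v := by
  unfold sinhc coshAverage
  split_ifs with h
  · have : v = 0 := by simpa using h
    simp [this]
  · have hv : v ≠ 0 := by simpa using h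
    have hd : ∀ s : ℝ, HasDerivAt (fun s ↦ Real.sinh (2 * v * s) / (2 * v))
        (1 * Real.cosh (2 * v * s)) s := fun s ↦ by
      have h1 : HasDerivAt (fun s : ℝ ↦ 2 * v * s) (2 * v) s := by
        simpa using (hasDerivAt_id' s).const_mul (2 * v)
      exact (h1.sinh.div_const (2 * v)).congr_deriv (by field_simp)
    rw [intervalIntegral.integral_eq_sub_of_hasDerivAt (fun s _ ↦ hd s)
      (Continuous.intervalIntegrable (by fun_prop) _ _)]
    simp

/-- `sinhc v` averages `exp(vσ)` over uniform `σ ∈ [-1, 1]`; squaring convolves the uniform law with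
itself, giving a triangular law, hence the weight `2(1 - s)`. -/
lemma sinhc_sq_eq_coshAverage (v : ℝ) :
    sinhc v ^ 2 = coshAverage (fun s ↦ 2 * (1 - s)) v := by
  unfold sinhc coshAverage
  split_ifs with h
  · have hd : ∀ s : ℝ, HasDerivAt (fun s : ℝ ↦ 2 * s - s ^ 2)
        (2 * (1 - s) * Real.cosh (2 * v * s)) s := fun s ↦ by
      refine (((hasDerivAt_id' s).const_mul 2).sub (hasDerivAt_pow 2 s)).congr_deriv ?_
      simp [h]
      ring
    rw [intervalIntegral.integral_eq_sub_of_hasDerivAt (fun s _ ↦ hd s)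
      (Continuous.intervalIntegrable (by fun_prop) _ _)]
    norm_num
  · have hd : ∀ s : ℝ, HasDerivAt
        (fun s ↦ (1 - s) * Real.sinh (2 * v * s) / v + Real.cosh (2 * v * s) / (2 * v ^ 2))
        (2 * (1 - s) * Real.cosh (2 * v * s)) s := fun s ↦ by
      have h1 : HasDerivAt (fun s : ℝ ↦ 2 * v * s) (2 * v) s := by
        simpa using (hasDerivAt_id' s).const_mul (2 * v)
      refine (((((hasDerivAt_id' s).const_sub 1).mul h1.sinh).div_const v).add
        (h1.cosh.div_const (2 * v ^ 2))).congr_deriv ?_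
      field_simp
      ring
    rw [intervalIntegral.integral_eq_sub_of_hasDerivAt (fun s _ ↦ hd s)
      (Continuous.intervalIntegrable (by fun_prop) _ _)]
    simp only [sub_self, zero_mul, zero_div, zero_add, mul_one, mul_zero, Real.sinh_zero,
      Real.cosh_zero]
    rw [Real.cosh_two_mul, Real.cosh_sq]
    field_simp
    ring

lemma measurable_sinhc : Measurable sinhc :=
  Measurable.ite (measurableSet_singleton 0) measurable_const (by fun_prop)

/-! ### Uniform bounds -/

lemma cosh_le_exp_of_mem {c y s : ℝ} (hy : |y| ≤ c / 4) (hs0 : 0 ≤ s) (hs1 : s ≤ 1) (ξ : ℝ) :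
    Real.cosh (2 * (ξ * y) * s) ≤ Real.exp (c / 2 * |ξ|) := by
  refine (cosh_le_exp_abs _).trans (Real.exp_le_exp.2 ?_)
  rw [abs_mul, abs_mul, abs_mul, abs_two, abs_of_nonneg hs0]
  have h1 : |y| * s ≤ c / 4 := (mul_le_of_le_one_right (abs_nonneg _) hs1).trans hy
  nlinarith [mul_le_mul_of_nonneg_left h1 (abs_nonneg ξ)]

lemma abs_coshAverage_le {w : ℝ → ℝ} (hw : ∀ s ∈ Set.Ioc (0 : ℝ) 1, |w s| ≤ 2) {c y : ℝ}
    (hy : |y| ≤ c / 4) (ξ : ℝ) :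
    |coshAverage w (ξ * y)| ≤ 2 * Real.exp (c / 2 * |ξ|) := by
  have h := intervalIntegral.norm_integral_le_of_norm_le_const (a := 0) (b := 1)
    (f := fun s ↦ w s * Real.cosh (2 * (ξ * y) * s)) (C := 2 * Real.exp (c / 2 * |ξ|))
    fun s hs ↦ by
      rw [Set.uIoc_of_le zero_le_one] at hs
      rw [norm_mul, Real.norm_eq_abs, Real.norm_of_nonneg (Real.cosh_pos _).le]
      gcongr
      · exact hw s hs
      · exact cosh_le_exp_of_mem hy hs.1.le hs.2 ξ
  simpa [coshAverage] using h

lemma weightedFourier_mul_exp_eq (ρ : Measure ℝ) (c : ℝ) (p : ℝ → ℝ) (a x : ℝ) :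
    weightedFourier ρ (fun ξ ↦ p ξ * Real.exp (2 * a * ξ)) x =
      ∫ ξ : ℝ, Complex.exp (-Complex.I * (ξ : ℂ) * (x : ℂ)) *
        ((p ξ * (Real.exp (2 * a * ξ) / Real.cosh (c * ξ)) : ℝ) : ℂ) ∂coshTilt ρ c := by
  rw [integral_coshTilt, weightedFourier]
  refine integral_congr_ae (.of_forall fun ξ ↦ ?_)
  have h : p ξ * Real.exp (2 * a * ξ) =
      Real.cosh (c * ξ) * (p ξ * (Real.exp (2 * a * ξ) / Real.cosh (c * ξ))) := by
    have := (Real.cosh_pos (c * ξ)).ne'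
    field_simp
  simp only [h]
  push_cast
  ring

/-- Averaging the exponential bound over the representation of `coshAverage`. -/
lemma enorm_weightedFourier_coshAverage_le {ρ : Measure ℝ} [IsFiniteMeasure ρ] {c : ℝ}
    (hρ : Integrable (fun ξ ↦ (1 + ξ ^ 2) * Real.exp (c / 2 * |ξ|)) ρ)
    {p : ℝ → ℝ} (hp : Continuous p) (hpb : ∀ ξ, |p ξ| ≤ 2 * (1 + ξ ^ 2)) {w : ℝ → ℝ}
    (hwc : Continuous w) (hw : ∀ s ∈ Set.Ioc (0 : ℝ) 1, |w s| ≤ 2) {x : ℝ} {M : ℝ≥0∞}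
    (hM : ∀ a : ℝ, |a| ≤ c / 4 →
      ‖weightedFourier ρ (fun ξ ↦ p ξ * Real.exp (2 * a * ξ)) x‖ₑ ≤ M)
    {y : ℝ} (hy : |y| ≤ c / 4) :
    ‖weightedFourier ρ (fun ξ ↦ p ξ * coshAverage w (ξ * y)) x‖ₑ ≤ 2 * M := by
  have hexp : ∀ a : ℝ, |a| ≤ c / 4 → ∀ ξ : ℝ,
      Real.exp (2 * a * ξ) ≤ Real.exp (c / 2 * |ξ|) := fun a ha ξ ↦ by
    refine Real.exp_le_exp.2 ((le_abs_self _).trans ?_)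
    rw [abs_mul, abs_mul, abs_two]
    nlinarith [mul_le_mul_of_nonneg_right ha (abs_nonneg ξ)]
  have hint : ∀ a : ℝ, |a| ≤ c / 4 → Integrable (fun ξ : ℝ ↦
      Complex.exp (-Complex.I * (ξ : ℂ) * (x : ℂ)) * ((p ξ * Real.exp (2 * a * ξ) : ℝ) : ℂ)) ρ := by
    intro a ha
    refine (hρ.const_mul 2).mono' (by fun_prop) (.of_forall fun ξ ↦ ?_)
    rw [norm_mul, norm_exp_neg_I_mul, one_mul, Complex.norm_real, norm_mul, Real.norm_eq_abs,
      Real.norm_of_nonneg (Real.exp_pos _).le, ← mul_assoc]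
    exact mul_le_mul (hpb ξ) (hexp a ha ξ) (Real.exp_pos _).le (by positivity)
  let Φ : ℝ → ℝ → ℂ := fun ξ s ↦ Complex.exp (-Complex.I * (ξ : ℂ) * (x : ℂ)) *
    ((p ξ * (w s * Real.cosh (2 * (ξ * y) * s)) : ℝ) : ℂ)
  have hrep : weightedFourier ρ (fun ξ ↦ p ξ * coshAverage w (ξ * y)) x =
      ∫ ξ, (∫ s in Set.Ioc (0 : ℝ) 1, Φ ξ s) ∂ρ := by
    refine integral_congr_ae (.of_forall fun ξ ↦ ?_)
    simp only [Φ, coshAverage]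
    rw [integral_const_mul, integral_complex_ofReal, integral_const_mul,
      intervalIntegral.integral_of_le zero_le_one]
  have hprod : Integrable (Function.uncurry Φ) (ρ.prod (volume.restrict (Set.Ioc (0 : ℝ) 1))) := by
    have hdom : Integrable (fun q : ℝ × ℝ ↦ 4 * ((1 + q.1 ^ 2) * Real.exp (c / 2 * |q.1|)))
        (ρ.prod (volume.restrict (Set.Ioc (0 : ℝ) 1))) := (hρ.const_mul 4).comp_fst _
    refine hdom.mono' (by simp only [Φ, Function.uncurry_def]; fun_prop) ?_
    have hae : ∀ᵐ q ∂ρ.prod (volume.restrict (Set.Ioc (0 : ℝ) 1)), q.2 ∈ Set.Ioc (0 : ℝ) 1 :=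
      Measure.quasiMeasurePreserving_snd.ae (ae_restrict_mem measurableSet_Ioc)
    filter_upwards [hae] with q hq
    simp only [Φ, Function.uncurry_def]
    rw [norm_mul, norm_exp_neg_I_mul, one_mul, Complex.norm_real, norm_mul, norm_mul,
      Real.norm_eq_abs, Real.norm_eq_abs, Real.norm_of_nonneg (Real.cosh_pos _).le]
    calc |p q.1| * (|w q.2| * Real.cosh (2 * (q.1 * y) * q.2))
        ≤ 2 * (1 + q.1 ^ 2) * (2 * Real.exp (c / 2 * |q.1|)) := by
          gcongr
          exacts [hpb _, hw _ hq, cosh_le_exp_of_mem hy hq.1.le hq.2 _]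
      _ = _ := by ring
  rw [hrep, integral_integral_swap hprod]
  refine (enorm_integral_le_lintegral_enorm _).trans ?_
  calc ∫⁻ s in Set.Ioc (0 : ℝ) 1, ‖∫ ξ, Φ ξ s ∂ρ‖ₑ
      ≤ ∫⁻ _ in Set.Ioc (0 : ℝ) 1, 2 * M := by
        refine setLIntegral_mono_ae' measurableSet_Ioc (.of_forall fun s hs ↦ ?_)
        have hys : |y * s| ≤ c / 4 := by
          rw [abs_mul, abs_of_pos hs.1]
          exact (mul_le_of_le_one_right (abs_nonneg _) hs.2).trans hy
        have hys' : |-(y * s)| ≤ c / 4 := by rwa [abs_neg]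
        -- The two exponentials of `cosh` have parameters `a = ±ys`, both admissible in `hM`; `|w| ≤
        -- 2` makes the prefactor at most 1.
        have heq : ∫ ξ, Φ ξ s ∂ρ = (w s / 2 : ℝ) *
            (weightedFourier ρ (fun ξ ↦ p ξ * Real.exp (2 * (y * s) * ξ)) x +
              weightedFourier ρ (fun ξ ↦ p ξ * Real.exp (2 * (-(y * s)) * ξ)) x) := by
          rw [weightedFourier, weightedFourier, ← integral_add (hint _ hys) (hint _ hys'),
            ← integral_const_mul]
          refine integral_congr_ae (.of_forall fun ξ ↦ ?_)
          simp only [Φ]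
          rw [Real.cosh_eq, show 2 * (ξ * y) * s = 2 * (y * s) * ξ by ring,
            show -(2 * (y * s) * ξ) = 2 * (-(y * s)) * ξ by ring]
          push_cast
          ring
        have hw1 : ‖((w s / 2 : ℝ) : ℂ)‖ₑ ≤ 1 := by
          rw [← ofReal_norm, Complex.norm_real, Real.norm_eq_abs, abs_div, abs_two]
          exact ENNReal.ofReal_le_one.2 (by linarith [hw s hs])
        rw [heq, enorm_mul]
        calc _ ≤ 1 * (M + M) :=
              mul_le_mul' hw1 ((enorm_add_le _ _).trans (add_le_add (hM _ hys) (hM _ hys')))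
          _ = 2 * M := by rw [one_mul, two_mul]
    _ = 2 * M := by simp

/-- The spare exponent `κ - c` absorbs the polynomial. -/
lemma integrable_one_add_sq_mul_exp {ρ : Measure ℝ} {κ c : ℝ} (hc : 0 ≤ c) (hcκ : c < κ)
    (h : ExpMoment ρ κ) : Integrable (fun ξ ↦ (1 + ξ ^ 2) * Real.exp (c / 2 * |ξ|)) ρ := by
  have hδ : 0 < κ - c := by linarith
  refine (h.const_mul (2 + 48 / (κ - c) ^ 4)).mono' (by fun_prop) (.of_forall fun ξ ↦ ?_)
  rw [Real.norm_of_nonneg (by positivity)]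
  have h1 := one_add_sq_sq_le_exp hδ ξ
  have h2 : 1 + ξ ^ 2 ≤ (1 + ξ ^ 2) ^ 2 := by nlinarith [sq_nonneg ξ, sq_nonneg (ξ ^ 2)]
  calc (1 + ξ ^ 2) * Real.exp (c / 2 * |ξ|)
      ≤ (2 + 48 / (κ - c) ^ 4) * Real.exp ((κ - c) * |ξ|) * Real.exp (c * |ξ|) := by
        gcongr
        · exact h2.trans h1
        · linarith
    _ = (2 + 48 / (κ - c) ^ 4) * Real.exp (|ξ| * κ) := by
        rw [mul_assoc, ← Real.exp_add]
        ring_nf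

lemma integrable_cosh_mul {ρ : Measure ℝ} {κ c : ℝ} (hc : 0 ≤ c) (hcκ : c ≤ κ)
    (h : ExpMoment ρ κ) : Integrable (fun ξ ↦ Real.cosh (c * ξ)) ρ := by
  refine h.mono' (by fun_prop) (.of_forall fun ξ ↦ ?_)
  rw [Real.norm_of_nonneg (Real.cosh_pos _).le]
  refine (cosh_le_exp_abs _).trans (Real.exp_le_exp.2 ?_)
  rw [abs_mul, abs_of_nonneg hc, mul_comm]
  gcongr

lemma integrable_mul_of_abs_le {ρ : Measure ℝ} {c : ℝ}
    (hρ : Integrable (fun ξ ↦ (1 + ξ ^ 2) * Real.exp (c / 2 * |ξ|)) ρ) {p g : ℝ → ℝ}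
    (hp : Measurable p) (hpb : ∀ ξ, |p ξ| ≤ 2 * (1 + ξ ^ 2)) (hg : Measurable g)
    (hgb : ∀ ξ, |g ξ| ≤ 2 * Real.exp (c / 2 * |ξ|)) : Integrable (fun ξ ↦ p ξ * g ξ) ρ := by
  refine (hρ.const_mul 4).mono' (by fun_prop) (.of_forall fun ξ ↦ ?_)
  rw [norm_mul, Real.norm_eq_abs, Real.norm_eq_abs]
  calc |p ξ| * |g ξ| ≤ 2 * (1 + ξ ^ 2) * (2 * Real.exp (c / 2 * |ξ|)) := by
        gcongr
        exacts [hpb ξ, hgb ξ]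
    _ = _ := by ring

/-- A single majorant `M`, independent of `y`, dominates all three families of terms, so the
supremum over `y` costs nothing. -/
theorem assumptionA_of_integrable {ρ : Measure ℝ} [IsFiniteMeasure ρ] {κ κo : ℝ}
    (hκo : 0 < κo) (hlt : κo < κ / 2) (hexp : ExpMoment ρ κ)
    (hJ : Integrable (fourierCov (coshTilt ρ (2 * κo)))) (hat : ∀ x : ℝ, ρ {x} = 0) :
    AssumptionA ρ κ := by
  set c := 2 * κo with hc
  have hc0 : 0 < c := by positivity
  have hρ := integrable_one_add_sq_mul_exp hc0.le (by linarith : c < κ) hexp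
  have hfin := isFiniteMeasure_coshTilt (integrable_cosh_mul hc0.le (by linarith : c ≤ κ) hexp)
  obtain ⟨B, hB⟩ := exists_exp_multiplier_bound hc0
  set M : ℝ → ℝ≥0∞ := fun x ↦ ENNReal.ofReal B * majorant (fourierCov (coshTilt ρ c)) x with hMdef
  have hexpB : ∀ (p p' p'' : ℝ → ℝ), QuadraticGrowth p p' p'' → ∀ x a : ℝ, |a| ≤ c / 4 →
      ‖weightedFourier ρ (fun ξ ↦ p ξ * Real.exp (2 * a * ξ)) x‖ₑ ≤ M x := by
    intro p p' p'' hp x a ha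
    rw [weightedFourier_mul_exp_eq ρ c]
    exact hB p p' p'' hp a ha _ x
  have hw1 : ∀ s ∈ Set.Ioc (0 : ℝ) 1, |(fun _ ↦ 1 : ℝ → ℝ) s| ≤ 2 := fun s _ ↦ by norm_num
  have hw2 : ∀ s ∈ Set.Ioc (0 : ℝ) 1, |(fun s ↦ 2 * (1 - s) : ℝ → ℝ) s| ≤ 2 := fun s hs ↦ by
    rw [abs_le]; constructor <;> linarith [hs.1, hs.2]
  have r1 : ∀ y : ℝ, (fun x ↦ rEll ρ 1 x (2 * y)) =
      weightedFourier ρ fun ξ ↦ sinhc (ξ * (2 * y)) := fun y ↦ by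
    funext x; simp only [rEll, weightedFourier, pow_one]
  have r2 : ∀ y : ℝ, (fun x ↦ rEll ρ 2 x y) =
      weightedFourier ρ fun ξ ↦ sinhc (ξ * y) ^ 2 := fun y ↦ rfl
  have s1 : ∀ y ξ : ℝ, sinhc (ξ * (2 * y)) = coshAverage (fun _ ↦ 1) (ξ * y) := fun y ξ ↦ by
    rw [← sinhc_two_mul_eq_coshAverage]; ring_nf
  have m1 : ∀ y : ℝ, Measurable fun ξ ↦ sinhc (ξ * (2 * y)) := fun y ↦
    measurable_sinhc.comp (by fun_prop)
  have m2 : ∀ y : ℝ, Measurable fun ξ ↦ sinhc (ξ * y) ^ 2 := fun y ↦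
    (measurable_sinhc.comp (by fun_prop)).pow_const 2
  have b1 : ∀ y : ℝ, |y| ≤ c / 4 → ∀ ξ, |sinhc (ξ * (2 * y))| ≤ 2 * Real.exp (c / 2 * |ξ|) :=
    fun y hy ξ ↦ by rw [s1]; exact abs_coshAverage_le hw1 hy ξ
  have b2 : ∀ y : ℝ, |y| ≤ c / 4 → ∀ ξ, |sinhc (ξ * y) ^ 2| ≤ 2 * Real.exp (c / 2 * |ξ|) :=
    fun y hy ξ ↦ by rw [sinhc_sq_eq_coshAverage]; exact abs_coshAverage_le hw2 hy ξ
  have int : ∀ g : ℝ → ℝ, Measurable g → (∀ ξ, |g ξ| ≤ 2 * Real.exp (c / 2 * |ξ|)) →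
      Integrable g ρ ∧ Integrable (fun ξ ↦ ξ * g ξ) ρ ∧ Integrable (fun ξ ↦ ξ * (ξ * g ξ)) ρ := by
    intro g hg hgb
    refine ⟨?_, ?_, ?_⟩
    · simpa using integrable_mul_of_abs_le hρ measurable_const quadraticGrowth_one.bound hg hgb
    · exact integrable_mul_of_abs_le hρ measurable_id quadraticGrowth_id.bound hg hgb
    · simpa [sq, mul_assoc] using
        integrable_mul_of_abs_le hρ (by fun_prop) quadraticGrowth_sq.bound hg hgb
  have B0 : ∀ x, ‖fourierCov ρ x‖ₑ ≤ M x := fun x ↦ by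
    have h := hexpB _ _ _ quadraticGrowth_one x 0 (by simp; positivity)
    simpa [weightedFourier, fourierCov] using h
  have B1 : ∀ y : ℝ, |y| ≤ c / 4 → ∀ x, ‖deriv (fun x ↦ rEll ρ 1 x (2 * y)) x‖ₑ ≤ 2 * M x := by
    intro y hy x
    obtain ⟨i0, i1, -⟩ := int _ (m1 y) (b1 y hy)
    rw [r1, deriv_weightedFourier i0 i1, enorm_mul, enorm_neg]
    have : ‖Complex.I‖ₑ = 1 := by rw [← ofReal_norm]; simp
    rw [this, one_mul]
    simp_rw [s1]
    exact enorm_weightedFourier_coshAverage_le hρ quadraticGrowth_id.continuous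
      quadraticGrowth_id.bound continuous_const hw1 (hexpB _ _ _ quadraticGrowth_id x) hy
  have B2 : ∀ y : ℝ, |y| ≤ c / 4 → ∀ x,
      ‖iteratedDeriv 2 (fun x ↦ rEll ρ 2 x y) x‖ₑ ≤ 2 * M x := by
    intro y hy x
    obtain ⟨i0, i1, i2⟩ := int _ (m2 y) (b2 y hy)
    rw [r2, iteratedDeriv_two_weightedFourier i0 i1 i2, enorm_neg]
    simp_rw [sinhc_sq_eq_coshAverage]
    exact enorm_weightedFourier_coshAverage_le hρ quadraticGrowth_sq.continuous
      quadraticGrowth_sq.bound (by fun_prop) hw2 (hexpB _ _ _ quadraticGrowth_sq x) hy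
  -- `κ' = c/4` keeps every exponent `a` admissible; `x⋆ = 2π` is the sampling step matched to the
  -- majorant.
  refine ⟨hat, by linarith, hexp, c / 4, 2 * Real.pi, by positivity, by linarith, by positivity,
    fun y hy ↦ ⟨?_, ?_⟩, ?_⟩
  · obtain ⟨i0, i1, -⟩ := int _ (m1 y) (b1 y hy.le)
    rw [r1]
    exact contDiff_one_weightedFourier i0 i1
  · obtain ⟨i0, i1, i2⟩ := int _ (m2 y) (b2 y hy.le)
    rw [r2]
    exact contDiff_two_weightedFourier i0 i1 i2
  · have hsum : ∑' j : ℕ, M ((j : ℝ) * (2 * Real.pi)) ≠ ∞ := by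
      simp only [hMdef]
      rw [ENNReal.tsum_mul_left]
      exact (ENNReal.mul_lt_top ENNReal.ofReal_lt_top
        (tsum_majorant_lt_top hJ (continuous_fourierCov _).measurable)).ne
    -- The 5 is `1 + 2 + 2`: `r` is bounded by `M`, each derivative term by `2M`.
    have htail := ENNReal.Tendsto.const_mul (a := 5) (ENNReal.tendsto_sum_nat_add _ hsum)
      (.inr (by simp))
    rw [mul_zero] at htail
    refine tendsto_of_tendsto_of_tendsto_of_le_of_le tendsto_const_nhds htail
      (fun _ ↦ zero_le) fun k ↦ ?_
    have hcomm : ∑' j : ℕ, M (((j + k : ℕ) : ℝ) * (2 * Real.pi)) =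
        ∑' j : ℕ, M (((k + j : ℕ) : ℝ) * (2 * Real.pi)) := by simp_rw [add_comm]
    simp only [hcomm]
    set S := ∑' j : ℕ, M (((k + j : ℕ) : ℝ) * (2 * Real.pi)) with hS
    have t2 : ∀ f : ℝ → ℂ, (∀ x, ‖f x‖ₑ ≤ 2 * M x) →
        ∑' j : ℕ, ‖f (((k + j : ℕ) : ℝ) * (2 * Real.pi))‖ₑ ≤ 2 * S := fun f hf ↦ by
      rw [hS, ← ENNReal.tsum_mul_left]
      exact ENNReal.tsum_le_tsum fun j ↦ hf _
    calc omegaStar ρ (c / 4) (2 * Real.pi) k ≤ S + (2 * S + 2 * S) := by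
          refine add_le_add (ENNReal.tsum_le_tsum fun j ↦ B0 _) (iSup₂_le fun y hy ↦ ?_)
          exact add_le_add (t2 _ (B1 y hy.le)) (t2 _ (B2 y hy.le))
      _ = 5 * S := by ring

/-! ### Smoothness of sample paths -/

/-- Fubini on `Ω × ℝ` needs joint measurability. Off a null set all rational times are
simultaneously measurable, and continuity passes this to every time. -/
lemma exists_measurable_continuous_modification {Ω : Type*} [MeasurableSpace Ω] {P : Measure Ω}
    {X : ℝ → Ω → ℝ} (hX : ∀ t, AEMeasurable (X t) P) (hc : ∀ᵐ ω ∂P, Continuous fun t ↦ X t ω) :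
    ∃ Y : ℝ → Ω → ℝ, (∀ ω, Continuous fun t ↦ Y t ω) ∧ (∀ t, Measurable (Y t)) ∧
      ∀ᵐ ω ∂P, ∀ t, Y t ω = X t ω := by
  have hq : ∀ᵐ ω ∂P, ∀ q : ℚ, X q ω = (hX q).mk (X q) ω :=
    ae_all_iff.2 fun q ↦ (hX q).ae_eq_mk
  obtain ⟨A, hA, hAm, hAsub⟩ := (hc.and hq).exists_measurable_mem
  classical
  have hcont : ∀ ω, Continuous fun t ↦ A.indicator (X t) ω := fun ω ↦ by
    by_cases hω : ω ∈ A
    · simpa [hω] using (hAsub ω hω).1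
    · simpa [hω] using continuous_const
  have hrat : ∀ q : ℚ, Measurable (A.indicator (X q)) := fun q ↦ by
    have : A.indicator (X q) = A.indicator ((hX q).mk (X q)) :=
      Set.indicator_congr fun ω hω ↦ (hAsub ω hω).2 q
    rw [this]
    exact (hX q).measurable_mk.indicator hAm
  refine ⟨fun t ↦ A.indicator (X t), hcont, fun t ↦ ?_, ?_⟩
  · obtain ⟨u, hu, hlim⟩ := mem_closure_iff_seq_limit.1 (Rat.denseRange_cast (𝕜 := ℝ) t)
    refine measurable_of_tendsto_metrizable (f := fun n ↦ A.indicator (X (u n))) (fun n ↦ ?_)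
      (tendsto_pi_nhds.2 fun ω ↦ ((hcont ω).tendsto t).comp hlim)
    obtain ⟨q, hq⟩ := hu n
    rw [← hq]
    exact hrat q
  · filter_upwards [hA] with ω hω t
    simp [hω]

/-- The character `(t, u) ↦ e^{-2πi (t - u) s}`. -/
noncomputable def phase (s : ℝ) (q : ℝ × ℝ) : ℂ :=
  Complex.exp (((-2 * Real.pi * (q.1 - q.2) * s : ℝ) : ℂ) * Complex.I)

lemma norm_phase (s : ℝ) (q : ℝ × ℝ) : ‖phase s q‖ = 1 := Complex.norm_exp_ofReal_mul_I _

lemma continuous_phase (s : ℝ) : Continuous (phase s) := by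
  unfold phase
  fun_prop

lemma norm_fourier_sq_eq (h : ℝ → ℝ) (s : ℝ) :
    ((‖𝓕 (fun t ↦ (h t : ℂ)) s‖ ^ 2 : ℝ) : ℂ) =
      ∫ q : ℝ × ℝ, phase s q * ((h q.1 * h q.2 : ℝ) : ℂ) := by
  push_cast
  rw [← Complex.mul_conj', Real.fourier_real_eq_integral_exp_smul, ← integral_conj,
    ← integral_prod_mul]
  refine integral_congr_ae (.of_forall fun q ↦ ?_)
  simp only [smul_eq_mul, map_mul, ← Complex.exp_conj, Complex.conj_ofReal, Complex.conj_I, phase]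
  rw [mul_mul_mul_comm, ← Complex.exp_add]
  push_cast
  congr 2
  ring

lemma phase_mul_exp (s ξ : ℝ) (q : ℝ × ℝ) :
    phase s q * Complex.exp (-Complex.I * (ξ : ℂ) * ((q.1 - q.2 : ℝ) : ℂ)) =
      phase (s + ξ / (2 * Real.pi)) q := by
  have hpi : (Real.pi : ℂ) ≠ 0 := by exact_mod_cast Real.pi_ne_zero
  rw [phase, phase, ← Complex.exp_add]
  congr 1
  push_cast
  field_simp
  ring

/-- Expand the square as a double integral, take expectations, and insert the spectral formula for
`r(t - u)`: each frequency `ξ` translates `s` by `ξ/(2π)`. -/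
lemma integral_norm_fourier_sq {Ω : Type*} [MeasurableSpace Ω] {P : Measure Ω}
    [IsProbabilityMeasure P] {Y : ℝ → Ω → ℝ} (hYm : Measurable (Function.uncurry Y))
    (hY2 : ∀ t, MemLp (Y t) 2 P) {ρ : Measure ℝ} [IsFiniteMeasure ρ] {r : ℝ → ℝ}
    (hr : ∀ t, (r t : ℂ) = fourierCov ρ t) (hcov : ∀ t u, ∫ ω, Y t ω * Y u ω ∂P = r (t - u))
    {χ : ℝ → ℝ} (hχ : Integrable χ) (s : ℝ) :
    Integrable (fun ω ↦ ‖𝓕 (fun t ↦ ((χ t * Y t ω : ℝ) : ℂ)) s‖ ^ 2) P ∧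
      ∫ ω, ‖𝓕 (fun t ↦ ((χ t * Y t ω : ℝ) : ℂ)) s‖ ^ 2 ∂P =
        ∫ ξ, ‖𝓕 (fun t ↦ (χ t : ℂ)) (s + ξ / (2 * Real.pi))‖ ^ 2 ∂ρ := by
  have hχχ : Integrable fun q : ℝ × ℝ ↦ χ q.1 * χ q.2 := hχ.mul_prod hχ
  have hYY : ∀ t u, Integrable (fun ω ↦ Y t ω * Y u ω) P := fun t u ↦ (hY2 t).integrable_mul (hY2 u)
  -- A bound uniform in `t` and `u`, by `2|ab| ≤ a² + b²`, so that integrability of `χ` alone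
  -- justifies Fubini.
  have hYYb : ∀ t u, ∫ ω, |Y t ω * Y u ω| ∂P ≤ r 0 := fun t u ↦ by
    have h1 : ∫ ω, |Y t ω * Y u ω| ∂P ≤ ∫ ω, (Y t ω * Y t ω + Y u ω * Y u ω) / 2 ∂P := by
      refine integral_mono (hYY t u).abs (((hYY t t).add (hYY u u)).div_const 2) fun ω ↦ ?_
      rw [abs_le]
      constructor <;> nlinarith [sq_nonneg (Y t ω - Y u ω), sq_nonneg (Y t ω + Y u ω)]
    rw [integral_div, integral_add (hYY t t) (hYY u u), hcov, hcov] at h1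
    simpa using h1
  let H : Ω × (ℝ × ℝ) → ℂ := fun z ↦
    phase s z.2 * (((χ z.2.1 * χ z.2.2) * (Y z.2.1 z.1 * Y z.2.2 z.1) : ℝ) : ℂ)
  have hχ2 : AEStronglyMeasurable (fun z : Ω × (ℝ × ℝ) ↦ χ z.2.1 * χ z.2.2)
      (P.prod (volume : Measure (ℝ × ℝ))) := hχχ.1.comp_snd
  have hYmeas : Measurable fun z : Ω × (ℝ × ℝ) ↦ Y z.2.1 z.1 * Y z.2.2 z.1 :=
    (hYm.comp (measurable_snd.fst.prodMk measurable_fst)).mul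
      (hYm.comp (measurable_snd.snd.prodMk measurable_fst))
  have hHm : AEStronglyMeasurable H (P.prod (volume : Measure (ℝ × ℝ))) := by
    refine AEStronglyMeasurable.mul ?_ (Complex.continuous_ofReal.comp_aestronglyMeasurable
      (hχ2.mul hYmeas.aestronglyMeasurable))
    exact ((continuous_phase s).measurable.comp measurable_snd).aestronglyMeasurable
  have hHn : ∀ z, ‖H z‖ = |χ z.2.1 * χ z.2.2| * |Y z.2.1 z.1 * Y z.2.2 z.1| := fun z ↦ by
    simp only [H]
    rw [norm_mul, norm_phase, one_mul, Complex.norm_real, Real.norm_eq_abs, abs_mul]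
  have hHi : Integrable H (P.prod (volume : Measure (ℝ × ℝ))) := by
    rw [integrable_prod_iff' hHm]
    refine ⟨.of_forall fun q ↦ ?_, ?_⟩
    · exact ((hYY q.1 q.2).const_mul (χ q.1 * χ q.2)).ofReal.const_mul (phase s q)
    · refine (hχχ.abs.mul_const (r 0)).mono' hHm.norm.prod_swap.integral_prod_right'
        (.of_forall fun q ↦ ?_)
      simp_rw [hHn]
      rw [integral_const_mul, Real.norm_of_nonneg
        (mul_nonneg (abs_nonneg _) (integral_nonneg fun _ ↦ abs_nonneg _))]
      gcongr
      exact hYYb _ _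
  have hsq : ∀ ω, ((‖𝓕 (fun t ↦ ((χ t * Y t ω : ℝ) : ℂ)) s‖ ^ 2 : ℝ) : ℂ) =
      ∫ q, H (ω, q) := fun ω ↦ by
    rw [norm_fourier_sq_eq]
    refine integral_congr_ae (.of_forall fun q ↦ ?_)
    simp only [H]
    congr 2
    ring
  have hI := hHi.integral_prod_left
  simp_rw [← hsq] at hI
  refine ⟨by simpa only [RCLike.re_eq_complex_re, Complex.ofReal_re] using hI.re, ?_⟩
  have hG : Integrable (Function.uncurry fun (q : ℝ × ℝ) (ξ : ℝ) ↦
      phase (s + ξ / (2 * Real.pi)) q * ((χ q.1 * χ q.2 : ℝ) : ℂ))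
      ((volume : Measure (ℝ × ℝ)).prod ρ) := by
    have h1 : Integrable (fun z : (ℝ × ℝ) × ℝ ↦ ((χ z.1.1 * χ z.1.2 : ℝ) : ℂ))
        ((volume : Measure (ℝ × ℝ)).prod ρ) := (hχχ.ofReal (𝕜 := ℂ)).comp_fst ρ
    refine h1.bdd_mul (c := 1) ?_ (.of_forall fun z ↦ (norm_phase _ _).le)
    refine Continuous.aestronglyMeasurable ?_
    unfold phase
    fun_prop
  have hmain : ((∫ ω, ‖𝓕 (fun t ↦ ((χ t * Y t ω : ℝ) : ℂ)) s‖ ^ 2 ∂P : ℝ) : ℂ) =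
      ((∫ ξ, ‖𝓕 (fun t ↦ (χ t : ℂ)) (s + ξ / (2 * Real.pi))‖ ^ 2 ∂ρ : ℝ) : ℂ) := by
    rw [← integral_complex_ofReal, ← integral_complex_ofReal]
    simp_rw [hsq, norm_fourier_sq_eq]
    rw [integral_integral_swap (f := fun ω q ↦ H (ω, q)) hHi, ← integral_integral_swap hG]
    refine integral_congr_ae (.of_forall fun q ↦ ?_)
    simp only [H]
    rw [integral_const_mul, integral_complex_ofReal, integral_const_mul, hcov]
    simp_rw [← phase_mul_exp]
    rw [Complex.ofReal_mul, hr, fourierCov]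
    simp_rw [mul_assoc]
    rw [integral_const_mul, ← mul_assoc, mul_comm (phase s q), mul_assoc]
    rw [← integral_const_mul, ← integral_const_mul, ← integral_const_mul]
    refine integral_congr_ae (.of_forall fun ξ ↦ ?_)
    simp only
    ring
  exact_mod_cast hmain

lemma one_add_sq_le_peetre (s b : ℝ) : 1 + s ^ 2 ≤ 2 * (1 + b ^ 2) * (1 + (s + b) ^ 2) := by
  nlinarith [sq_nonneg (s + 2 * b), sq_nonneg (b * (s + b))]

lemma integrable_one_add_sq_pow_of_expMoment {ρ : Measure ℝ} {κ : ℝ} (hκ : 0 < κ)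
    (h : ExpMoment ρ κ) (m : ℕ) :
    Integrable (fun ξ : ℝ ↦ (1 + (ξ / (2 * Real.pi)) ^ 2) ^ m) ρ := by
  refine (h.const_mul (((2 * m).factorial : ℝ) / κ ^ (2 * m) * Real.exp κ)).mono' (by fun_prop)
    (.of_forall fun ξ ↦ ?_)
  rw [Real.norm_of_nonneg (by positivity)]
  have h1 : 1 + (ξ / (2 * Real.pi)) ^ 2 ≤ (1 + |ξ|) ^ 2 := by
    have h2 : (ξ / (2 * Real.pi)) ^ 2 ≤ ξ ^ 2 := by
      rw [div_pow]
      exact div_le_self (sq_nonneg _) (by nlinarith [Real.pi_gt_three])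
    nlinarith [sq_abs ξ, abs_nonneg ξ]
  have h3 := Real.pow_div_factorial_le_exp (κ * (1 + |ξ|)) (by positivity) (2 * m)
  rw [mul_pow, div_le_iff₀ (by positivity)] at h3
  calc (1 + (ξ / (2 * Real.pi)) ^ 2) ^ m ≤ ((1 + |ξ|) ^ 2) ^ m := by gcongr
    _ = (1 + |ξ|) ^ (2 * m) := by rw [pow_mul]
    _ ≤ Real.exp (κ * (1 + |ξ|)) * ((2 * m).factorial : ℝ) / κ ^ (2 * m) := by
        rw [le_div_iff₀ (by positivity)]
        linarith
    _ = ((2 * m).factorial : ℝ) / κ ^ (2 * m) * Real.exp κ * Real.exp (|ξ| * κ) := by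
        rw [show κ * (1 + |ξ|) = κ + |ξ| * κ by ring, Real.exp_add]
        ring

lemma lintegral_one_add_sq_pow_mul_schwartz_lt_top (ψ : SchwartzMap ℝ ℂ) (m : ℕ) :
    ∫⁻ s : ℝ, ENNReal.ofReal ((1 + s ^ 2) ^ m * ‖ψ s‖ ^ 2) < ∞ := by
  have hb := SchwartzMap.one_add_le_sup_seminorm_apply (𝕜 := ℝ) (m := (m + 1, 0)) le_rfl le_rfl ψ
  simp only [norm_iteratedFDeriv_zero] at hb
  set C := 2 ^ (m + 1) * ((Finset.Iic (m + 1, 0)).sup fun m ↦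
    SchwartzMap.seminorm ℝ m.1 m.2) ψ with hC
  refine (lintegral_mono fun s ↦ ENNReal.ofReal_le_ofReal ?_).trans_lt
    (integrable_inv_one_add_sq.const_mul (C ^ 2)).lintegral_lt_top
  rw [← div_eq_mul_inv, le_div_iff₀ (by positivity)]
  have h1 : 1 + s ^ 2 ≤ (1 + ‖s‖) ^ 2 := by
    rw [Real.norm_eq_abs]
    nlinarith [sq_abs s, abs_nonneg s]
  calc (1 + s ^ 2) ^ m * ‖ψ s‖ ^ 2 * (1 + s ^ 2) = (1 + s ^ 2) ^ (m + 1) * ‖ψ s‖ ^ 2 := by ring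
    _ ≤ ((1 + ‖s‖) ^ 2) ^ (m + 1) * ‖ψ s‖ ^ 2 := by gcongr
    _ = ((1 + ‖s‖) ^ (m + 1) * ‖ψ s‖) ^ 2 := by
        rw [mul_pow, ← pow_mul, ← pow_mul, mul_comm 2]
    _ ≤ C ^ 2 := by
        gcongr
        exact hb s

/-- A continuous integrable function whose Fourier transform is square integrable against all
polynomial weights is smooth. -/
lemma contDiff_of_lintegral_fourier_sq_lt_top {g : ℝ → ℂ} (hg : Continuous g)
    (hgi : Integrable g)
    (h : ∀ m : ℕ, ∫⁻ s : ℝ, ENNReal.ofReal ((1 + s ^ 2) ^ m * ‖𝓕 g s‖ ^ 2) < ∞) :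
    ContDiff ℝ (⊤ : ℕ∞) g := by
  have hc := continuous_fourier_of_integrable hgi
  have hint : ∀ n : ℕ, Integrable fun s : ℝ ↦ ‖s‖ ^ n * ‖𝓕 g s‖ := by
    intro n
    have h1 : Integrable fun s : ℝ ↦ (1 + s ^ 2) ^ (n + 1) * ‖𝓕 g s‖ ^ 2 := by
      refine ⟨by fun_prop, ?_⟩
      rw [hasFiniteIntegral_iff_ofReal (.of_forall fun s ↦ by positivity)]
      exact h (n + 1)
    refine (integrable_inv_one_add_sq.add h1).mono' (by fun_prop) (.of_forall fun s ↦ ?_)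
    rw [Real.norm_of_nonneg (by positivity)]
    have hD : 0 < 1 + s ^ 2 := by positivity
    set x := ‖s‖ ^ n * ‖𝓕 g s‖ with hx
    have hx2 : (1 + s ^ 2) * x ^ 2 ≤ (1 + s ^ 2) ^ (n + 1) * ‖𝓕 g s‖ ^ 2 := by
      have h2 : (‖s‖ ^ 2) ^ n ≤ (1 + s ^ 2) ^ n := by
        gcongr
        rw [Real.norm_eq_abs, sq_abs]
        linarith
      calc (1 + s ^ 2) * x ^ 2 = (1 + s ^ 2) * ((‖s‖ ^ 2) ^ n * ‖𝓕 g s‖ ^ 2) := by rw [hx]; ring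
        _ ≤ (1 + s ^ 2) * ((1 + s ^ 2) ^ n * ‖𝓕 g s‖ ^ 2) := by gcongr
        _ = _ := by ring
    -- Either `x` is below the integrable inverse weight, or `(1 + s²) x > 1` and the quadratic term
    -- dominates. The extra power in `h (n + 1)` pays for this weight.
    have hx3 : x ≤ (1 + s ^ 2)⁻¹ + (1 + s ^ 2) * x ^ 2 := by
      have h3 : (1 + s ^ 2)⁻¹ * (1 + s ^ 2) = 1 := inv_mul_cancel₀ hD.ne'
      have h4 : 0 < (1 + s ^ 2)⁻¹ := inv_pos.2 hD
      by_cases hle : x ≤ (1 + s ^ 2)⁻¹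
      · exact hle.trans (le_add_of_nonneg_right (by positivity))
      · push Not at hle
        nlinarith [mul_pos hD (h4.trans hle)]
    simp only [Pi.add_apply]
    linarith
  have hi : Integrable (𝓕 g) := by
    have := hint 0
    simp only [pow_zero, one_mul] at this
    exact (integrable_norm_iff hc.aestronglyMeasurable).1 this
  have hinv := hg.fourierInv_fourier_eq hgi hi
  have heq : g = fun t ↦ 𝓕 (𝓕 g) (-t) := by
    conv_lhs => rw [← hinv]
    funext t
    rw [Real.fourierInv_eq_fourier_neg]
  rw [heq]
  exact (Real.contDiff_fourier (N := ⊤) fun n _ ↦ hint n).comp contDiff_neg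

/-- Integrate the second-moment identity against `(1 + s²)^m`. Peetre's inequality transfers the
weight to the shifted argument at the price of a polynomial moment of `ρ`; finite expectation gives
almost sure finiteness, for all `m` at once. -/
lemma ae_contDiff_mul_of_spectral {Ω : Type*} [MeasurableSpace Ω] {P : Measure Ω}
    [IsProbabilityMeasure P] {Y : ℝ → Ω → ℝ} (hYc : ∀ ω, Continuous fun t ↦ Y t ω)
    (hYm : Measurable (Function.uncurry Y))
    (hY2 : ∀ t, MemLp (Y t) 2 P) {ρ : Measure ℝ} [IsFiniteMeasure ρ] {r : ℝ → ℝ}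
    (hr : ∀ t, (r t : ℂ) = fourierCov ρ t) (hcov : ∀ t u, ∫ ω, Y t ω * Y u ω ∂P = r (t - u))
    (hmom : ∀ m : ℕ, Integrable (fun ξ : ℝ ↦ (1 + (ξ / (2 * Real.pi)) ^ 2) ^ m) ρ)
    {χ : ℝ → ℝ} (hχ : ContDiff ℝ (⊤ : ℕ∞) χ) (hχc : HasCompactSupport χ) :
    ∀ᵐ ω ∂P, ContDiff ℝ (⊤ : ℕ∞) fun t ↦ χ t * Y t ω := by
  have hχi : Integrable χ := hχ.continuous.integrable_of_hasCompactSupport hχc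
  have hg₁ : HasCompactSupport (Complex.ofRealCLM ∘ χ) := hχc.comp_left rfl
  have hg₂ : ContDiff ℝ (⊤ : ℕ∞) (Complex.ofRealCLM ∘ χ) := by fun_prop
  set ψ : SchwartzMap ℝ ℂ := 𝓕 (hg₁.toSchwartzMap hg₂) with hψ
  have hψeq : ∀ s, 𝓕 (fun t ↦ (χ t : ℂ)) s = ψ s := fun s ↦ by
    rw [hψ, SchwartzMap.fourier_coe]
    rfl
  set F : Ω → ℝ → ℂ := fun ω s ↦ 𝓕 (fun t ↦ ((χ t * Y t ω : ℝ) : ℂ)) s with hF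
  have hFm : Measurable (Function.uncurry F) := by
    have h1 : Measurable (Function.uncurry fun (z : Ω × ℝ) (t : ℝ) ↦
        Complex.exp (((-2 * Real.pi * t * z.2 : ℝ) : ℂ) * Complex.I) •
          ((χ t * Y t z.1 : ℝ) : ℂ)) := by
      have h2 : Measurable fun z : (Ω × ℝ) × ℝ ↦ Y z.2 z.1.1 :=
        hYm.comp (measurable_snd.prodMk measurable_fst.fst)
      have h3 := hχ.continuous.measurable
      simp only [Function.uncurry_def]
      fun_prop
    have h4 := h1.stronglyMeasurable.integral_prod_right' (ν := (volume : Measure ℝ))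
    convert h4.measurable using 1
    funext z
    simp only [Function.uncurry_def, hF, Real.fourier_real_eq_integral_exp_smul]
  have hkey : ∀ m : ℕ, ∀ᵐ ω ∂P,
      ∫⁻ s : ℝ, ENNReal.ofReal ((1 + s ^ 2) ^ m * ‖F ω s‖ ^ 2) < ∞ := by
    intro m
    have hmeas : Measurable (Function.uncurry fun (ω : Ω) (s : ℝ) ↦
        ENNReal.ofReal ((1 + s ^ 2) ^ m * ‖F ω s‖ ^ 2)) := by
      have : Measurable fun z : Ω × ℝ ↦ F z.1 z.2 := hFm
      simp only [Function.uncurry_def]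
      fun_prop
    refine ae_lt_top hmeas.lintegral_prod_right' ?_
    rw [lintegral_lintegral_swap hmeas.aemeasurable]
    have h1 : ∀ s : ℝ, ∫⁻ ω, ENNReal.ofReal ((1 + s ^ 2) ^ m * ‖F ω s‖ ^ 2) ∂P =
        ∫⁻ ξ, ENNReal.ofReal ((1 + s ^ 2) ^ m * ‖ψ (s + ξ / (2 * Real.pi))‖ ^ 2) ∂ρ := by
      intro s
      obtain ⟨i1, e1⟩ := integral_norm_fourier_sq hYm hY2 hr hcov hχi s
      simp_rw [hψeq] at e1
      have i2 : Integrable (fun ξ ↦ ‖ψ (s + ξ / (2 * Real.pi))‖ ^ 2) ρ := by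
        obtain ⟨C, -, hC⟩ := ψ.decay 0 0
        refine Integrable.of_bound (C := C ^ 2) ?_ (.of_forall fun ξ ↦ ?_)
        · have := ψ.continuous
          exact (by fun_prop : Continuous _).aestronglyMeasurable
        · rw [Real.norm_of_nonneg (by positivity)]
          gcongr
          simpa using hC (s + ξ / (2 * Real.pi))
      rw [← ofReal_integral_eq_lintegral_ofReal (i1.const_mul _)
          (.of_forall fun _ ↦ by positivity),
        ← ofReal_integral_eq_lintegral_ofReal (i2.const_mul _)
          (.of_forall fun _ ↦ by positivity), integral_const_mul, integral_const_mul, e1]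
    simp_rw [h1]
    rw [lintegral_lintegral_swap (by
      have := ψ.continuous.measurable
      exact (by fun_prop : Measurable _).aemeasurable)]
    have h2 : ∀ ξ : ℝ, ∫⁻ s : ℝ,
        ENNReal.ofReal ((1 + s ^ 2) ^ m * ‖ψ (s + ξ / (2 * Real.pi))‖ ^ 2) ≤
        ENNReal.ofReal (2 ^ m * (1 + (ξ / (2 * Real.pi)) ^ 2) ^ m) *
          ∫⁻ s : ℝ, ENNReal.ofReal ((1 + s ^ 2) ^ m * ‖ψ s‖ ^ 2) := by
      intro ξ
      rw [← lintegral_add_right_eq_self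
          (fun s : ℝ ↦ ENNReal.ofReal ((1 + s ^ 2) ^ m * ‖ψ s‖ ^ 2)) (ξ / (2 * Real.pi)),
        ← lintegral_const_mul' _ _ ENNReal.ofReal_ne_top]
      refine lintegral_mono fun s ↦ ?_
      rw [← ENNReal.ofReal_mul (by positivity)]
      refine ENNReal.ofReal_le_ofReal ?_
      rw [← mul_assoc, ← mul_pow, ← mul_pow]
      gcongr
      exact one_add_sq_le_peetre _ _
    refine ((lintegral_mono h2).trans_lt ?_).ne
    rw [lintegral_mul_const _ (by fun_prop)]
    exact ENNReal.mul_lt_top ((hmom m).const_mul _).lintegral_lt_top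
      (lintegral_one_add_sq_pow_mul_schwartz_lt_top ψ m)
  filter_upwards [ae_all_iff.2 hkey] with ω hω
  have hcω : Continuous fun t ↦ ((χ t * Y t ω : ℝ) : ℂ) :=
    Complex.continuous_ofReal.comp (hχ.continuous.mul (hYc ω))
  have hcs : HasCompactSupport fun t ↦ ((χ t * Y t ω : ℝ) : ℂ) :=
    (hχc.mul_right (f' := fun t ↦ Y t ω)).comp_left Complex.ofReal_zero
  have h := contDiff_of_lintegral_fourier_sq_lt_top hcω
    (hcω.integrable_of_hasCompactSupport hcs) hω
  exact Complex.reCLM.contDiff.comp h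

lemma contDiff_of_forall_contDiff_bump_mul {y : ℝ → ℝ}
    (h : ∀ n : ℕ, ContDiff ℝ (⊤ : ℕ∞) fun t ↦
      (⟨n + 1, n + 2, by positivity, by linarith⟩ : ContDiffBump (0 : ℝ)) t * y t) :
    ContDiff ℝ (⊤ : ℕ∞) y := by
  rw [contDiff_iff_contDiffAt]
  intro t
  obtain ⟨n, hn⟩ := exists_nat_gt |t|
  refine (h n).contDiffAt.congr_of_eventuallyEq ?_
  have hmem : Metric.ball (0 : ℝ) (n + 1) ∈ 𝓝 t :=
    Metric.isOpen_ball.mem_nhds (by simpa using hn.trans (by linarith))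
  filter_upwards [hmem] with u hu
  rw [ContDiffBump.one_of_mem_closedBall _ (Metric.ball_subset_closedBall hu), one_mul]

lemma IsNormalizedStationaryGaussian.memLp {Ω : Type*} [MeasurableSpace Ω] {P : Measure Ω}
    {X : ℝ → Ω → ℝ} (hX : IsNormalizedStationaryGaussian X P) (t : ℝ) : MemLp (X t) 2 P :=
  (hX.gaussian.hasGaussianLaw_eval t).memLp (by simp)

/-- Shifting the pair of times `t - u`, `0` by `u` preserves the joint law. -/
lemma IsNormalizedStationaryGaussian.integral_mul {Ω : Type*} [MeasurableSpace Ω]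
    {P : Measure Ω} {X : ℝ → Ω → ℝ} (hX : IsNormalizedStationaryGaussian X P) (t u : ℝ) :
    ∫ ω, X t ω * X u ω ∂P = autocov X P (t - u) := by
  have hm : Measurable fun v : ({t - u, 0} : Finset ℝ) → ℝ ↦
      v ⟨t - u, by simp⟩ * v ⟨0, by simp⟩ := by fun_prop
  have h := (hX.stationary u {t - u, 0}).comp hm
  have h1 := h.integral_eq
  simp only [Function.comp_def, sub_add_cancel, zero_add] at h1
  simp only [h1, autocov, covariance, hX.centered, sub_zero]

/-- Absolute continuity enters only through continuity of paths. Countably many cutoffs, equal to 1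
on growing balls, cover the line. -/
theorem IsNormalizedStationaryGaussian.ae_contDiff {Ω : Type*} [MeasurableSpace Ω]
    {P : Measure Ω} [IsProbabilityMeasure P] {X : ℝ → Ω → ℝ}
    (hX : IsNormalizedStationaryGaussian X P) {ρ : Measure ℝ} (hρ : IsSpectralMeasure X P ρ)
    {κ : ℝ} (hκ : 0 < κ) (hexp : ExpMoment ρ κ) :
    ∀ᵐ ω ∂P, ContDiff ℝ (⊤ : ℕ∞) fun t ↦ X t ω := by
  have := hρ.isProbabilityMeasure
  have hcont : ∀ᵐ ω ∂P, Continuous fun t ↦ X t ω := by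
    filter_upwards [hX.paths] with ω hω
    refine continuous_iff_continuousAt.2 fun t ↦ ?_
    have h := (hω (t - 1) (t + 1)).continuousOn
    rw [Set.uIcc_of_le (by linarith)] at h
    exact h.continuousAt (Icc_mem_nhds (by linarith) (by linarith))
  obtain ⟨Y, hYc, hYm, hYX⟩ := exists_measurable_continuous_modification
    (fun t ↦ hX.gaussian.aemeasurable t) hcont
  have hae : ∀ t, Y t =ᵐ[P] X t := fun t ↦ hYX.mono fun ω hω ↦ hω t
  have hcov : ∀ t u, ∫ ω, Y t ω * Y u ω ∂P = autocov X P (t - u) := fun t u ↦ by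
    rw [← hX.integral_mul]
    exact integral_congr_ae ((hae t).mul (hae u))
  have hYu : Measurable (Function.uncurry Y) :=
    measurable_uncurry_of_continuous_of_measurable hYc hYm
  have h := fun n : ℕ ↦ ae_contDiff_mul_of_spectral hYc hYu
    (fun t ↦ (hX.memLp t).ae_eq (hae t).symm) hρ.autocov_eq hcov
    (integrable_one_add_sq_pow_of_expMoment hκ hexp)
    (χ := (⟨n + 1, n + 2, by positivity, by linarith⟩ : ContDiffBump (0 : ℝ)))
    (ContDiffBump.contDiff _) (ContDiffBump.hasCompactSupport _)
  filter_upwards [hYX, ae_all_iff.2 h] with ω hω hs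
  simp_rw [← hω]
  exact contDiff_of_forall_contDiff_bump_mul hs

end StationaryGaussian

/-! ### Reduction of both conditions to an integrable tilted transform -/

open StationaryGaussian in
theorem propositionp {Ω : Type*} [MeasurableSpace Ω] (P : Measure Ω) [IsProbabilityMeasure P]
    (X : ℝ → Ω → ℝ) (hX : IsNormalizedStationaryGaussian X P)
    (ρ : Measure ℝ) (hρ : IsSpectralMeasure X P ρ) (κ : ℝ) (hκ : 0 < κ)
    (h : (IsCompact ρ.support ∧ Integrable (autocov X P) volume) ∨
      (ExpMoment ρ κ ∧ ∃ κo : ℝ, 0 < κo ∧ κo < κ / 2 ∧ Integrable (rTilted ρ κo) volume)) :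
    AssumptionA ρ κ ∧
    HasBoundedContinuousDensity ρ ∧
    ∀ᵐ ω ∂P, ContDiff ℝ (⊤ : ℕ∞) (fun t : ℝ ↦ X t ω) := by
  have := hρ.isProbabilityMeasure
  obtain ⟨hexp, κo, hκo, hlt, hJ⟩ : ExpMoment ρ κ ∧ ∃ κo : ℝ, 0 < κo ∧ κo < κ / 2 ∧
      Integrable (fourierCov (coshTilt ρ (2 * κo))) := by
    rcases h with ⟨hsupp, hr⟩ | ⟨hexp, κo, hκo, hlt, hr⟩
    · have hexp := expMoment_of_isCompact_support hsupp hκ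
      have hcov : Integrable (fourierCov ρ) := by
        rw [← funext hρ.autocov_eq]
        exact hr.ofReal
      -- Compact support allows any tilt; `κ/4` is just a point of `(0, κ/2)`.
      exact ⟨hexp, κ / 4, by positivity, by linarith,
        integrable_fourierCov_coshTilt_of_isCompact_support hsupp hcov _
          (integrable_cosh_mul (by positivity) (by linarith) hexp)⟩
    · refine ⟨hexp, κo, hκo, hlt, ?_⟩
      rw [funext (fourierCov_coshTilt (map_neg_eq_of_fourierCov_real hρ.autocov_eq)
        (integrable_cosh_mul (by positivity) (by linarith) hexp))]
      exact hr.ofReal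
  have := isFiniteMeasure_coshTilt
    (integrable_cosh_mul (c := 2 * κo) (by positivity) (by linarith) hexp)
  have hdens : HasBoundedContinuousDensity ρ :=
    hasBoundedContinuousDensity_of_coshTilt (hasBoundedContinuousDensity_of_integrable _ hJ)
  exact ⟨assumptionA_of_integrable hκo hlt hexp hJ (noAtoms_of_hasBoundedContinuousDensity hdens),
    hdens, hX.ae_contDiff hρ hκ hexp⟩
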